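/- Let $D$ be a division algebra of degree $d$ with centre $C$ (so $[D:C]=d^2<\infty$), and let $\sigma$ be an automorphism of $D$ of finite inner order $n$: there is $u\in D^\times$ with $\sigma^n(x)=uxu^{-1}$ for all $x\in D$, and $\sigma^i$ is not an inner automorphism for $1\le i<n$. Choose $u$ so that $\sigma(u)=u$. Let $F=C\cap\mathrm{Fix}(\sigma)$ and let $R=D[t;\sigma]$ be the skew polynomial ring with $ta=\sigma(a)t$ for $a\in D$; its centre is $F[u^{-1}t^n]\cong F[x]$. Let $f\in R$ be monic of degree $m\ge 1$ such that the greatest common right divisor of $f$ and $t$ is $1$. Let $h(t)=\hat h(u^{-1}t^n)$, with $\hat h\in F[x]$ monic, be the minimal central left multiple of $f$, i.e. the nonzero central element of $R$ of least degree lying in $Rf$, normalised so that $\hat h$ is monic, and suppose that $\hat h$ is irreducible in $F[x]$. The eigenring of $f$ is $\mathcal E(f)=\{g\in R: fg\in Rf\}/Rf$, and $f$ is called a generalised A-polynomial if $\mathcal E(f)$ is a central simple algebra over $F$. For $c\in D^\times$ and $b\in D$ put $\Omega_c(b)=\sigma(c)\,b\,c^{-1}$. All products below are taken in the order of increasing index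 from left to right. Suppose that $n$ is prime and $n\ne d$. Then $f$ is a generalised A-polynomial if and only if one of the following holds: (i) there exists $a\in F^\times$ such that $ua\neq\prod_{j=1}^{n}\sigma^{n-j}(b)$ for every $b\in D$, and $f(t)=t^n-ua$; (ii) $m\le n$ and there exist $c_1,\dots,c_m,b\in D^\times$ with $c_m=1$ such that $u^{-1}\prod_{j=0}^{n-1}\sigma^{n-j}(b)\in F^\times$ and $f(t)=\prod_{i=1}^{m}(t-\Omega_{c_i}(b))$. Moreover, in case (i), $f$ is irreducible in $R$. -/

import Mathlib

/-!
The skew polynomial ring `D[t;σ]` is Mathlib's `SkewPolynomial D`: left coefficients, variable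
`t = SkewPolynomial.X`, multiplication rule `t * a = σ(a) * t`, where the twist `σ` is
`SkewPolynomial.φ`, the action of the generator of `Multiplicative ℕ` on `D`.
-/

namespace GenAPoly

noncomputable section

section Eigenring

variable (F : Type*) {R : Type*} [CommRing F] [Ring R] [Algebra F R]

/-- The left idealiser `{g ∈ R : f g ∈ R f}` of `f`, as an `F`-subalgebra of `R`.
(`Ideal.span {f}` is the left ideal `R f`.) -/
def idealiser (f : R) : Subalgebra F R where
  carrier := {g | f * g ∈ Ideal.span {f}}
  mul_mem' := by
    intro a b ha hb
    obtain ⟨r, hr⟩ := Ideal.mem_span_singleton'.1 ha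
    have h : f * (a * b) = r * (f * b) := by rw [← mul_assoc, ← hr, mul_assoc]
    rw [Set.mem_ofPred_eq, h]
    exact Ideal.mul_mem_left _ r hb
  add_mem' := by
    intro a b ha hb
    rw [Set.mem_ofPred_eq, mul_add]
    exact Ideal.add_mem _ ha hb
  algebraMap_mem' := by
    intro r
    rw [Set.mem_ofPred_eq, ← Algebra.commutes r f]
    exact Ideal.mul_mem_left _ _ (Ideal.mem_span_singleton_self f)

/-- The left ideal `R f`, seen inside the idealiser of `f`. -/
def eigenIdeal (f : R) : Ideal (idealiser F f) :=
  (Ideal.span {f}).comap (idealiser F f).val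

instance eigenIdeal_isTwoSided (f : R) : (eigenIdeal F f).IsTwoSided where
  mul_mem_of_left := by
    intro a b ha
    obtain ⟨r, hr⟩ := Ideal.mem_span_singleton'.1 (show (a : R) ∈ Ideal.span {f} from ha)
    have h : ((a * b : idealiser F f) : R) = r * (f * (b : R)) := by
      rw [← mul_assoc, hr]; rfl
    change ((a * b : idealiser F f) : R) ∈ Ideal.span {f}
    rw [h]
    exact Ideal.mul_mem_left _ r b.2

/-- The eigenring of `f`: the quotient of the idealiser of `f` by `R f`. -/
abbrev Eigenring (f : R) : Type _ := idealiser F f ⧸ eigenIdeal F f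

end Eigenring

/-- `A` is a (finite-dimensional) central simple algebra over the field `F`. -/
structure IsCentralSimpleAlgebra (F A : Type*) [Field F] [Ring A] [Algebra F A] : Prop where
  central : Algebra.IsCentral F A
  simple : IsSimpleRing A
  finite : FiniteDimensional F A

section Skew

/-- `τ` is an inner automorphism `x ↦ v x v⁻¹` of `D`. -/
def IsInner {D : Type*} [DivisionRing D] (τ : D → D) : Prop :=
  ∃ v : Dˣ, ∀ x, τ x = v * x * (v⁻¹ : Dˣ)

/-- `Ω_v(α) = σ(v) α v⁻¹`. -/
def Omega {D : Type*} [DivisionRing D] (σ : D ≃+* D) (v : Dˣ) (α : D) : D :=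
  σ v * α * (v⁻¹ : Dˣ)

/-- The degree of a skew polynomial, with `deg 0 = ⊥`. -/
def degree {D : Type*} [DivisionRing D] (p : SkewPolynomial D) : WithBot ℕ :=
  p.support.max

variable (C D : Type*) [Field C] [DivisionRing D] [Algebra C D]
  [MulSemiringAction (Multiplicative ℕ) D]

/-- The field `F = C ∩ Fix(σ)`, as a subfield of `C`, where `σ` is the twist of `D[t;σ]`. -/
def fixedField : Subfield C where
  carrier := {x | SkewPolynomial.φ (algebraMap C D x) = algebraMap C D x}
  mul_mem' := by
    intro a b ha hb
    rw [Set.mem_ofPred_eq] at *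
    rw [map_mul, map_mul, ha, hb]
  one_mem' := by rw [Set.mem_ofPred_eq, map_one, map_one]
  add_mem' := by
    intro a b ha hb
    rw [Set.mem_ofPred_eq] at *
    rw [map_add, map_add, ha, hb]
  zero_mem' := by rw [Set.mem_ofPred_eq, map_zero, map_zero]
  neg_mem' := by
    intro a ha
    rw [Set.mem_ofPred_eq] at *
    rw [map_neg, map_neg, ha]
  inv_mem' := by
    intro a ha
    rw [Set.mem_ofPred_eq] at *
    rw [map_inv₀, map_inv₀, ha]

/-- The twist is `F`-linear; this is what makes `D[t;σ]` an `F`-algebra in Mathlib. -/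
instance fixedField_smulCommClass :
    SMulCommClass (Multiplicative ℕ) (fixedField C D) D where
  smul_comm k r x := by
    have h : ∀ k : Multiplicative ℕ,
        k • algebraMap C D (r : C) = algebraMap C D (r : C) := by
      intro k
      have hk : k = Multiplicative.ofAdd (Multiplicative.toAdd k) := rfl
      rw [hk, ← SkewPolynomial.φ_iterate_apply]
      exact Function.iterate_fixed r.2 _
    change k • ((r : C) • x) = (r : C) • (k • x)
    rw [Algebra.smul_def, Algebra.smul_def, smul_mul', h]

variable {D}

/-- `f ∈ D[t;σ]` is a generalised A-polynomial: its eigenring is a central simple algebra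
over `F`. -/
def IsGeneralisedAPolynomial (f : SkewPolynomial D) : Prop :=
  IsCentralSimpleAlgebra (fixedField C D) (Eigenring (fixedField C D) f)

/-- The greatest common right divisor of `f` and `g` is `1`: every common right divisor is a
unit. -/
def RightCoprime (f g : SkewPolynomial D) : Prop :=
  ∀ q, (∃ a, f = a * q) → (∃ b, g = b * q) → IsUnit q

variable {C}

/-- The element `ĥ(u⁻¹ t^n)` of `D[t;σ]`, for `ĥ ∈ F[x]`. -/
def evalCentral (u : Dˣ) (n : ℕ) (hhat : Polynomial (fixedField C D)) : SkewPolynomial D :=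
  Polynomial.aeval
    (SkewPolynomial.C ((u⁻¹ : Dˣ) : D) * SkewPolynomial.X ^ n : SkewPolynomial D) hhat

/-- `ĥ ∈ F[x]` is monic and `h = ĥ(u⁻¹ t^n)` is the minimal central left multiple of `f`:
it is central, of the form `g f`, and of least degree among the nonzero central left multiples
of `f`. -/
structure IsMinCentralLeftMultiple (u : Dˣ) (n : ℕ) (f : SkewPolynomial D)
    (hhat : Polynomial (fixedField C D)) : Prop where
  monic : hhat.Monic
  central : evalCentral u n hhat ∈ Subring.center (SkewPolynomial D)
  leftMultiple : ∃ g, evalCentral u n hhat = g * f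
  minimal : ∀ q ∈ Subring.center (SkewPolynomial D), q ≠ 0 → (∃ g, q = g * f) →
    degree (evalCentral u n hhat) ≤ degree q

end Skew

end

end GenAPoly

/-! Write `R = D[t;σ]`, `z = u⁻¹tⁿ` and `h_a = z - a` (`centralBinomial u n a`). The theorem reduces
to one criterion: `f` is a generalised A-polynomial iff `h_a ∈ R f` for some nonzero `a ∈ F`.

If the eigenring is central over `F`, the class of the central element `z` in it is a scalar `a`, so
`h_a ∈ R f` (`IsGeneralisedAPolynomial.exists_mem_span`); `a = 0` would give `tⁿ ∈ R f`, impossible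
when `f` has nonzero constant term. Conversely, for `a ≠ 0` the algebra `S = R / R h_a` is central
simple, because a two-sided ideal strictly above `R h_a` contains `1` (`one_mem_of_not_le`). The
eigenring of a nonunit right divisor of `h_a` is a corner `eSe`, hence central simple
(`isCentralSimpleAlgebra_eigenring`).

It remains to find the right divisors of `h_a`. The least positive degree of such a divisor divides
`n` (`dvd_sub_degree`), so for `n` prime it is `n` or `1`. If it is `n`, then `f = tⁿ - ua`. If it
is `1`, some `t - b` divides `h_a`, which means that `ua` is the norm of `b`; the simple `S`-module
is then `R / R(t - b)`, and every monic right divisor splits into factors `t - Ω_c(b)`. For a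
product as in (ii), a power of `h_a` lies in `R f`, and irreducibility of `ĥ` lowers the exponent to
one. -/

namespace GenAPoly

open SkewPolynomial

/-! ### Degree, right division and left ideals in `D[t;σ]` -/

section SkewDegree

variable {D : Type*} [DivisionRing D]

theorem degree_lt_iff {p : SkewPolynomial D} {k : ℕ} :
    degree p < k ↔ ∀ i, k ≤ i → p.coeff i = 0 := by
  unfold degree
  rw [Finset.max_eq_sup_coe]
  refine (Finset.sup_lt_iff (WithBot.bot_lt_coe k)).trans ?_
  constructor
  · intro h i hi
    by_contra hc
    exact absurd (WithBot.coe_lt_coe.1 (h i (mem_support_iff.2 hc))) (not_lt.2 hi)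
  · intro h i hi
    refine WithBot.coe_lt_coe.2 (not_le.1 fun hk => mem_support_iff.1 hi (h i hk))

theorem degree_le_iff {p : SkewPolynomial D} {k : ℕ} :
    degree p ≤ k ↔ ∀ i, k < i → p.coeff i = 0 := by
  unfold degree
  rw [Finset.max_le_iff]
  constructor
  · intro h i hi
    by_contra hc
    exact absurd (WithBot.coe_le_coe.1 (h i (mem_support_iff.2 hc))) (not_le.2 hi)
  · intro h i hi
    refine WithBot.coe_le_coe.2 (not_lt.1 fun hk => mem_support_iff.1 hi (h i hk))

theorem degree_eq_iff {p : SkewPolynomial D} {k : ℕ} :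
    degree p = k ↔ p.coeff k ≠ 0 ∧ ∀ i, k < i → p.coeff i = 0 := by
  rw [← degree_le_iff]
  constructor
  · intro h
    exact ⟨mem_support_iff.1 (Finset.mem_of_max h), h.le⟩
  · rintro ⟨h1, h2⟩
    exact le_antisymm h2 (Finset.le_max (mem_support_iff.2 h1))

theorem degree_eq_bot {p : SkewPolynomial D} : degree p = ⊥ ↔ p = 0 := by
  rw [degree, Finset.max_eq_bot, support_eq_empty]

theorem exists_degree_eq {p : SkewPolynomial D} (hp : p ≠ 0) : ∃ k : ℕ, degree p = k := by
  obtain ⟨k, hk⟩ := WithBot.ne_bot_iff_exists.1 (mt degree_eq_bot.1 hp)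
  exact ⟨k, hk.symm⟩

theorem ne_zero_of_degree_eq {p : SkewPolynomial D} {k : ℕ} (h : degree p = k) : p ≠ 0 := by
  rintro rfl
  exact (degree_eq_iff.1 h).1 rfl

theorem degree_monomial {k : ℕ} {c : D} (hc : c ≠ 0) : degree (monomial k c) = k := by
  rw [degree, support_monomial k hc, Finset.max_singleton]
  rfl

theorem degree_C {c : D} (hc : c ≠ 0) : degree (C c) = (0 : ℕ) :=
  degree_monomial (k := 0) hc

theorem eq_C_of_degree_lt_one {p : SkewPolynomial D} (h : degree p < (1 : ℕ)) :
    p = C (p.coeff 0) := by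
  ext i
  rcases i with _ | i
  · simp
  · rw [coeff_C_succ]
    exact degree_lt_iff.1 h _ (by omega)

theorem degree_sub_lt {p q : SkewPolynomial D} {k : ℕ} (hp : degree p = k) (hq : degree q = k)
    (h : p.coeff k = q.coeff k) : degree (p - q) < k := by
  rw [degree_lt_iff]
  intro i hi
  rw [coeff_sub]
  rcases hi.eq_or_lt with rfl | hi
  · rw [h, sub_self]
  · rw [(degree_eq_iff.1 hp).2 i hi, (degree_eq_iff.1 hq).2 i hi, sub_zero]

theorem degree_X_sub_C (b : D) : degree (X - C b) = (1 : ℕ) := by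
  rw [degree_eq_iff]
  refine ⟨by simp, fun i hi => ?_⟩
  rw [coeff_sub, coeff_X_of_ne_one hi.ne', coeff_C_ne_zero (by omega), sub_zero]

theorem coeff_X_sub_C_one (b : D) : (X - C b).coeff 1 = 1 := by simp

variable [MulSemiringAction (Multiplicative ℕ) D]

theorem coeff_mul_antidiagonal (p q : SkewPolynomial D) (k : ℕ) :
    (p * q).coeff k =
      ∑ x ∈ Finset.HasAntidiagonal.antidiagonal k, p.coeff x.1 * φ^[x.1] (q.coeff x.2) := by
  classical
  have h := SkewMonoidAlgebra.coeff_mul_antidiagonal_of_finset p q (Multiplicative.ofAdd k)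
    ((Finset.HasAntidiagonal.antidiagonal k).map
      ⟨fun x => (Multiplicative.ofAdd x.1, Multiplicative.ofAdd x.2), fun x y h => by
        simpa [Prod.ext_iff] using h⟩) (by
      rintro ⟨a, b⟩
      induction a using Multiplicative.rec
      induction b using Multiplicative.rec
      rw [← ofAdd_add, Multiplicative.ofAdd.injective.eq_iff, Finset.mem_map]
      constructor
      · rintro ⟨⟨i, j⟩, hij, hx⟩
        cases hx
        exact Finset.HasAntidiagonal.mem_antidiagonal.1 hij
      · intro hij
        exact ⟨(_, _), Finset.HasAntidiagonal.mem_antidiagonal.2 hij, rfl⟩)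
  rw [Finset.sum_map] at h
  simp only [φ_iterate_apply]
  exact h

theorem phi_iterate_eq_zero {k : ℕ} {x : D} : φ^[k] x = 0 ↔ x = 0 := by
  constructor
  · intro h
    exact (φ : D →+* D).injective.iterate k (by rw [h, iterate_map_zero])
  · rintro rfl
    exact iterate_map_zero _ _

theorem coeff_mul_zero (p q : SkewPolynomial D) : (p * q).coeff 0 = p.coeff 0 * q.coeff 0 := by
  simp [coeff_mul_antidiagonal]

theorem coeff_mul_add_of_degree_le {p q : SkewPolynomial D} {k l : ℕ} (hp : degree p ≤ k)
    (hq : degree q ≤ l) : (p * q).coeff (k + l) = p.coeff k * φ^[k] (q.coeff l) := by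
  rw [degree_le_iff] at hp hq
  rw [coeff_mul_antidiagonal, Finset.sum_eq_single (k, l)]
  · rintro ⟨i, j⟩ hij hne
    rw [Finset.HasAntidiagonal.mem_antidiagonal] at hij
    dsimp only at hij ⊢
    rcases lt_trichotomy i k with h | rfl | h
    · rw [hq j (by omega), iterate_map_zero, mul_zero]
    · exact absurd (by rw [Nat.add_left_cancel hij]) hne
    · rw [hp i h, zero_mul]
  · intro h
    exact absurd (Finset.HasAntidiagonal.mem_antidiagonal.2 (by rfl)) h

theorem degree_mul_of_eq {p q : SkewPolynomial D} {k l : ℕ} (hp : degree p = k)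
    (hq : degree q = l) : degree (p * q) = ((k + l : ℕ) : WithBot ℕ) := by
  rw [degree_eq_iff, coeff_mul_add_of_degree_le hp.le hq.le]
  rw [degree_eq_iff] at hp hq
  refine ⟨mul_ne_zero hp.1 (mt phi_iterate_eq_zero.1 hq.1), fun i hi => ?_⟩
  rw [coeff_mul_antidiagonal]
  refine Finset.sum_eq_zero fun x hx => ?_
  rw [Finset.HasAntidiagonal.mem_antidiagonal] at hx
  by_cases h : k < x.1
  · rw [hp.2 _ h, zero_mul]
  · rw [hq.2 x.2 (by omega), iterate_map_zero, mul_zero]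

instance : NoZeroDivisors (SkewPolynomial D) where
  eq_zero_or_eq_zero_of_mul_eq_zero {p q} h := by
    by_contra! hpq
    obtain ⟨k, hk⟩ := exists_degree_eq hpq.1
    obtain ⟨l, hl⟩ := exists_degree_eq hpq.2
    exact ne_zero_of_degree_eq (degree_mul_of_eq hk hl) h

instance : IsDomain (SkewPolynomial D) := NoZeroDivisors.to_isDomain _

theorem isUnit_C {c : D} (hc : c ≠ 0) : IsUnit (C c : SkewPolynomial D) :=
  (IsUnit.mk0 c hc).map (CRingHom : D →+* SkewPolynomial D)

theorem isUnit_iff_degree {p : SkewPolynomial D} : IsUnit p ↔ degree p = (0 : ℕ) := by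
  constructor
  · rintro ⟨v, rfl⟩
    obtain ⟨k, hk⟩ := exists_degree_eq v.ne_zero
    obtain ⟨l, hl⟩ := exists_degree_eq v⁻¹.ne_zero
    have h := degree_mul_of_eq hk hl
    rw [Units.mul_inv, ← C_1, degree_C one_ne_zero, Nat.cast_inj] at h
    rw [hk, Nat.cast_inj]
    omega
  · intro h
    have h0 := (degree_eq_iff.1 h).1
    rw [eq_C_of_degree_lt_one (p := p) (by rw [h]; exact_mod_cast Nat.zero_lt_one)]
    exact isUnit_C h0

theorem X_mul_C (b : D) : X * C b = C (φ b) * X := by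
  rw [C_mul_X_eq_monomial, ← monomial_zero_left, X_mul_monomial]

/-- Right division with remainder in `D[t;σ]`. -/
theorem exists_eq_mul_add {q : SkewPolynomial D} (hq : q ≠ 0) (p : SkewPolynomial D) :
    ∃ s r, p = s * q + r ∧ degree r < degree q := by
  obtain ⟨l, hl⟩ := exists_degree_eq hq
  rw [hl]
  suffices H : ∀ (k : ℕ) (p : SkewPolynomial D), degree p < k →
      ∃ s r, p = s * q + r ∧ degree r < l by
    rcases eq_or_ne p 0 with rfl | hp
    · exact H 0 0 (by rw [degree_eq_bot.2 rfl]; exact WithBot.bot_lt_coe _)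
    · obtain ⟨k, hk⟩ := exists_degree_eq hp
      exact H (k + 1) p (by rw [hk]; exact_mod_cast Nat.lt_succ_self k)
  intro k
  induction k with
  | zero =>
    intro p hp
    refine ⟨0, p, by simp, hp.trans_le ?_⟩
    exact_mod_cast Nat.zero_le l
  | succ k ih =>
    intro p hp
    by_cases hkl : k + 1 ≤ l
    · exact ⟨0, p, by simp, hp.trans_le (by exact_mod_cast hkl)⟩
    have hkl' : (k - l) + l = k := by omega
    have hp' : degree p ≤ k := by
      rw [degree_le_iff]
      exact fun i hi => degree_lt_iff.1 hp i hi
    by_cases hpk : p.coeff k = 0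
    · refine ih p (degree_lt_iff.2 fun i hi => ?_)
      rcases hi.eq_or_lt with rfl | hi
      · exact hpk
      · exact degree_le_iff.1 hp' i hi
    have hv : φ^[k - l] (q.coeff l) ≠ 0 := mt phi_iterate_eq_zero.1 (degree_eq_iff.1 hl).1
    -- Moving `t^(k-l)` past the leading coefficient of `q` twists it, so this `c` makes the leading
    -- terms cancel.
    set c : D := p.coeff k * (φ^[k - l] (q.coeff l))⁻¹ with hc
    have hc0 : c ≠ 0 := mul_ne_zero hpk (inv_ne_zero hv)
    have hm : degree (monomial (k - l) c) = ((k - l : ℕ) : WithBot ℕ) := degree_monomial hc0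
    have hmq : degree (monomial (k - l) c * q) = k := by
      rw [degree_mul_of_eq hm hl, hkl']
    have hlt : degree (p - monomial (k - l) c * q) < k := by
      refine degree_sub_lt (degree_eq_iff.2 ⟨hpk, degree_le_iff.1 hp'⟩) hmq ?_
      have hco := coeff_mul_add_of_degree_le hm.le hl.le
      rw [hkl'] at hco
      rw [hco, coeff_monomial, if_pos rfl, hc, mul_assoc,
        inv_mul_cancel₀ hv, mul_one]
    obtain ⟨s, r, hsr, hr⟩ := ih _ hlt
    exact ⟨s + monomial (k - l) c, r, by rw [add_mul, add_right_comm, ← hsr, sub_add_cancel], hr⟩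

theorem degree_le_of_mem_span {p q : SkewPolynomial D} (hp : p ≠ 0)
    (h : p ∈ Ideal.span {q}) : degree q ≤ degree p := by
  obtain ⟨s, rfl⟩ := Ideal.mem_span_singleton'.1 h
  obtain ⟨k, hk⟩ := exists_degree_eq (left_ne_zero_of_mul hp)
  obtain ⟨l, hl⟩ := exists_degree_eq (right_ne_zero_of_mul hp)
  rw [degree_mul_of_eq hk hl, hl]
  exact_mod_cast Nat.le_add_left l k

/-- Every left ideal of `D[t;σ]` is principal. -/
theorem exists_eq_span (I : Ideal (SkewPolynomial D)) : ∃ q, I = Ideal.span {q} := by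
  classical
  by_cases hI : ∃ p ∈ I, p ≠ 0
  · have hex : ∃ k : ℕ, ∃ p ∈ I, degree p = k := by
      obtain ⟨p, hp, hp0⟩ := hI
      obtain ⟨k, hk⟩ := exists_degree_eq hp0
      exact ⟨k, p, hp, hk⟩
    obtain ⟨q, hqI, hq⟩ := Nat.find_spec hex
    refine ⟨q, le_antisymm (fun p hp => ?_) ((Ideal.span_singleton_le_iff_mem I).2 hqI)⟩
    obtain ⟨s, r, rfl, hr⟩ := exists_eq_mul_add (ne_zero_of_degree_eq hq) p
    have hrI : r ∈ I := by
      have := I.sub_mem hp (I.mul_mem_left s hqI)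
      rwa [add_sub_cancel_left] at this
    rcases eq_or_ne r 0 with rfl | hr0
    · rw [add_zero]
      exact Ideal.mem_span_singleton'.2 ⟨s, rfl⟩
    · obtain ⟨k, hk⟩ := exists_degree_eq hr0
      rw [hk, hq, Nat.cast_lt] at hr
      exact absurd ⟨r, hrI, hk⟩ (Nat.find_min hex hr)
  · push Not at hI
    refine ⟨0, le_antisymm (fun p hp => ?_) ?_⟩
    · rw [hI p hp]
      exact zero_mem _
    · rw [Ideal.span_singleton_le_iff_mem]
      exact zero_mem _

/-- The bounded left Ore condition. -/
theorem exists_mul_mem_span {p : SkewPolynomial D} (hp : p ≠ 0) (w : SkewPolynomial D) :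
    ∃ s, s ≠ 0 ∧ degree s ≤ degree p ∧ s * w ∈ Ideal.span {p} := by
  obtain ⟨k, hk⟩ := exists_degree_eq hp
  induction k using Nat.strong_induction_on generalizing p w with
  | _ k ih =>
    obtain ⟨q, r, rfl, hr⟩ := exists_eq_mul_add hp w
    rcases eq_or_ne r 0 with rfl | hr0
    · refine ⟨1, one_ne_zero, ?_, ?_⟩
      · rw [hk, ← C_1, degree_C one_ne_zero]
        exact_mod_cast Nat.zero_le k
      · rw [one_mul, add_zero]
        exact Ideal.mem_span_singleton'.2 ⟨q, rfl⟩
    · obtain ⟨l, hl⟩ := exists_degree_eq hr0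
      have hlk : l < k := by
        rw [hk, hl] at hr
        exact_mod_cast hr
      -- The roles of `p` and `r` swap: `s p = s' r` puts `s' w` in `R p`, and `deg s' + deg r = deg
      -- s + deg p` with `deg s ≤ deg r` bounds `deg s'` by `deg p`.
      obtain ⟨s, hs0, hs, hsp⟩ := ih l hlk hr0 p hl
      obtain ⟨s', hs'⟩ := Ideal.mem_span_singleton'.1 hsp
      have hs'0 : s' ≠ 0 := by
        rintro rfl
        rw [zero_mul] at hs'
        exact mul_ne_zero hs0 hp hs'.symm
      refine ⟨s', hs'0, ?_, ?_⟩
      · obtain ⟨a, ha⟩ := exists_degree_eq hs0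
        obtain ⟨b, hb⟩ := exists_degree_eq hs'0
        have h1 := degree_mul_of_eq hb hl
        rw [hs', degree_mul_of_eq ha hk, Nat.cast_inj] at h1
        rw [ha, hl, Nat.cast_le] at hs
        rw [hb, hk, Nat.cast_le]
        omega
      · rw [mul_add, hs', ← mul_assoc]
        exact Ideal.add_mem _ (Ideal.mem_span_singleton'.2 ⟨_, rfl⟩)
          (Ideal.mem_span_singleton'.2 ⟨_, rfl⟩)

end SkewDegree

/-! ### The central polynomials `u⁻¹tⁿ - a` and their divisors -/

section InnerTwist

variable {D : Type*} [DivisionRing D]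

/-- The norm `σ ^ (k - 1) (b) ⋯ σ(b) b`. -/
def skewNorm (σ : D ≃+* D) (k : ℕ) (b : D) : D :=
  ((List.range' 1 k).map fun j => σ^[k - j] b).prod

theorem map_list_prod_iterate (σ : D ≃+* D) (b : D) (k : ℕ) (l : List ℕ) (hl : ∀ j ∈ l, j ≤ k) :
    σ ((l.map fun j => σ^[k - j] b).prod) = (l.map fun j => σ^[k + 1 - j] b).prod := by
  rw [map_list_prod, List.map_map]
  congr 1
  refine List.map_congr_left fun j hj => ?_
  rw [Function.comp_apply, Nat.sub_add_comm (hl j hj), Function.iterate_succ_apply']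

theorem skewNorm_succ (σ : D ≃+* D) (k : ℕ) (b : D) :
    skewNorm σ (k + 1) b = σ (skewNorm σ k b) * b := by
  rw [skewNorm, List.range'_1_concat, List.map_append, List.prod_append, skewNorm,
    map_list_prod_iterate]
  · simp [add_comm]
  · intro j hj
    rw [List.mem_range'_1] at hj
    omega

/-- Links the two norms of the theorem: the product in (ii) is `σ` of the one in (i). -/
theorem map_skewNorm (σ : D ≃+* D) (n : ℕ) (b : D) :
    σ (skewNorm σ n b) = ((List.range n).map fun j => σ^[n - j] b).prod := by
  rw [skewNorm, map_list_prod_iterate, List.range'_eq_map_range, List.map_map]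
  · congr 1
    refine List.map_congr_left fun j _ => ?_
    rw [Function.comp_apply, Nat.add_comm 1 j, Nat.add_sub_add_right]
  · intro j hj
    rw [List.mem_range'_1] at hj
    omega

variable [MulSemiringAction (Multiplicative ℕ) D]

theorem coeff_C_mul (y : D) (p : SkewPolynomial D) (i : ℕ) :
    (C y * p).coeff i = y * p.coeff i :=
  SkewMonoidAlgebra.coeff_single_one_mul p y _

theorem coeff_mul_C (p : SkewPolynomial D) (y : D) (i : ℕ) :
    (p * C y).coeff i = p.coeff i * φ^[i] y := by
  rw [φ_iterate_apply]
  exact SkewMonoidAlgebra.coeff_mul_single_one p y _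

/-- The twist `σ` of `D[t;σ]` has inner order `n`, with `σ ^ n` the conjugation by the
`σ`-invariant unit `u`. -/
structure IsInnerTwist (σ : D ≃+* D) (u : Dˣ) (n : ℕ) : Prop where
  twist : ∀ x : D, φ x = σ x
  iterate_eq : ∀ x : D, σ^[n] x = u * x * (u⁻¹ : Dˣ)
  not_isInner : ∀ i : ℕ, 1 ≤ i → i < n → ¬ IsInner (σ^[i])
  fixed : σ u = u

/-- The element `u⁻¹ t ^ n` of `D[t;σ]`. -/
noncomputable def centralVar (u : Dˣ) (n : ℕ) : SkewPolynomial D :=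
  C ((u⁻¹ : Dˣ) : D) * X ^ n

/-- The element `u⁻¹ t ^ n - a` of `D[t;σ]`. -/
noncomputable def centralBinomial (u : Dˣ) (n : ℕ) (a : D) : SkewPolynomial D :=
  centralVar u n - C a

/-- The elements of the centre of `D` fixed by `σ`. -/
def IsFixedCentral (σ : D ≃+* D) (a : D) : Prop :=
  σ a = a ∧ ∀ x, a * x = x * a

theorem centralVar_eq_monomial (u : Dˣ) (n : ℕ) :
    (centralVar u n : SkewPolynomial D) = monomial n ((u⁻¹ : Dˣ) : D) := by
  rw [centralVar, C_mul_X_pow_eq_monomial]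

theorem C_mul_centralBinomial (u : Dˣ) (n : ℕ) (a : D) :
    C (u : D) * centralBinomial u n a = X ^ n - C (u * a) := by
  rw [centralBinomial, centralVar, mul_sub, ← mul_assoc, ← C_mul, ← C_mul, Units.mul_inv, C_1,
    one_mul]

theorem centralBinomial_eq_C_mul (u : Dˣ) (n : ℕ) (a : D) :
    centralBinomial u n a = C ((u⁻¹ : Dˣ) : D) * (X ^ n - C (u * a)) := by
  rw [← C_mul_centralBinomial, ← mul_assoc, ← C_mul, Units.inv_mul, C_1, one_mul]

theorem degree_centralBinomial (u : Dˣ) {n : ℕ} (hn : 0 < n) (a : D) :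
    degree (centralBinomial u n a) = n := by
  rw [degree_eq_iff, centralBinomial, centralVar_eq_monomial]
  refine ⟨?_, fun i hi => ?_⟩
  · rw [coeff_sub, coeff_monomial, if_pos rfl, coeff_C_ne_zero hn.ne', sub_zero]
    exact u⁻¹.ne_zero
  · rw [coeff_sub, coeff_monomial, if_neg hi.ne, coeff_C_ne_zero (by omega), sub_zero]

/-- `h p = p h = p g p`, and `p` cancels in the domain `R`. -/
theorem eq_mul_of_central_eq_mul {h g p : SkewPolynomial D} (hc : ∀ q, h * q = q * h)
    (h0 : h ≠ 0) (e : h = g * p) : h = p * g := by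
  have hp : p ≠ 0 := by
    rintro rfl
    exact h0 (by rw [e, mul_zero])
  refine mul_right_cancel₀ hp ?_
  rw [hc, mul_assoc, ← e]

/-- Allows a right factor to be split off a divisor of `h` while the cofactor still divides `h` on
the right. -/
theorem central_mem_span_left {h p q : SkewPolynomial D} (hc : ∀ q, h * q = q * h)
    (h0 : h ≠ 0) (e : h ∈ Ideal.span {p * q}) : h ∈ Ideal.span {p} := by
  obtain ⟨g, hg⟩ := Ideal.mem_span_singleton'.1 e
  rw [← mul_assoc] at hg
  exact Ideal.mem_span_singleton'.2
    ⟨q * g, by rw [mul_assoc]; exact (eq_mul_of_central_eq_mul hc h0 hg.symm).symm⟩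

variable {σ : D ≃+* D} {u : Dˣ} {n : ℕ}

namespace IsInnerTwist

theorem phi_iterate (H : IsInnerTwist σ u n) (k : ℕ) (x : D) : φ^[k] x = σ^[k] x := by
  have : (⇑(φ : D →+* D)) = σ := funext H.twist
  rw [this]

theorem iterate_unit (H : IsInnerTwist σ u n) (k : ℕ) : σ^[k] ((u⁻¹ : Dˣ) : D) = (u⁻¹ : Dˣ) := by
  refine Function.iterate_fixed ?_ k
  rw [Units.val_inv_eq_inv_val, map_inv₀, H.fixed]

/-- The rule for `σⁿ` makes `u⁻¹tⁿ` commute with constants, and `σ(u) = u` makes it commute with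
`t`. -/
theorem centralVar_mul (H : IsInnerTwist σ u n) (p : SkewPolynomial D) :
    centralVar u n * p = p * centralVar u n := by
  rw [centralVar_eq_monomial]
  induction p using SkewPolynomial.induction with
  | h0 => simp
  | ha k r q _ _ ih =>
    rw [mul_add, add_mul, ih, monomial_mul_monomial, monomial_mul_monomial, H.phi_iterate,
      H.phi_iterate, H.iterate_eq, H.iterate_unit, ← mul_assoc, ← mul_assoc, Units.inv_mul,
      one_mul, add_comm n k]

theorem C_mul_of_fixed (H : IsInnerTwist σ u n) {a : D} (ha : IsFixedCentral σ a)
    (p : SkewPolynomial D) : C a * p = p * C a := by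
  ext i
  rw [coeff_C_mul, coeff_mul_C, H.phi_iterate, Function.iterate_fixed ha.1, ha.2]

theorem centralBinomial_mul (H : IsInnerTwist σ u n) {a : D} (ha : IsFixedCentral σ a)
    (p : SkewPolynomial D) : centralBinomial u n a * p = p * centralBinomial u n a := by
  rw [centralBinomial, sub_mul, mul_sub, H.centralVar_mul, H.C_mul_of_fixed ha]

theorem isTwoSided_span (H : IsInnerTwist σ u n) {a : D} (ha : IsFixedCentral σ a) :
    (Ideal.span {centralBinomial u n a}).IsTwoSided where
  mul_mem_of_left := by
    intro p q hp
    obtain ⟨s, rfl⟩ := Ideal.mem_span_singleton'.1 hp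
    rw [mul_assoc, H.centralBinomial_mul ha, ← mul_assoc]
    exact Ideal.mem_span_singleton'.2 ⟨_, rfl⟩

/-- A coefficient intertwining two different powers of `σ` below the inner order vanishes. -/
theorem eq_zero_of_intertwines (H : IsInnerTwist σ u n) {i k : ℕ} (hik : i < k) (hk : k < n)
    {c : D} (hc : ∀ y, c * σ^[i] y = σ^[k] y * c) : c = 0 := by
  by_contra hc0
  refine H.not_isInner (k - i) (by omega) (by omega) ⟨Units.mk0 c hc0, fun x => ?_⟩
  obtain ⟨y, rfl⟩ := (σ.surjective.iterate i) x
  rw [← Function.iterate_add_apply, Nat.sub_add_cancel hik.le, Units.val_mk0, hc y, mul_assoc,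
    Units.val_inv_eq_inv_val, Units.val_mk0, mul_inv_cancel₀ hc0, mul_one]

/-- The ideal generated by `u⁻¹ t ^ n - a`, with `a ≠ 0`, is a maximal two-sided ideal. -/
theorem one_mem_of_not_le (H : IsInnerTwist σ u n) (hn : 0 < n) {a : D} (ha0 : a ≠ 0)
    (I : Ideal (SkewPolynomial D)) [I.IsTwoSided] (hI : centralBinomial u n a ∈ I)
    (hle : ¬ I ≤ Ideal.span {centralBinomial u n a}) : 1 ∈ I := by
  have hdeg := degree_centralBinomial u hn a
  obtain ⟨g, hgI, hg⟩ := SetLike.not_le_iff_exists.1 hle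
  obtain ⟨q, rfl⟩ := exists_eq_span I
  obtain ⟨s, r, rfl, hr⟩ := exists_eq_mul_add (ne_zero_of_degree_eq hdeg) g
  have hr0 : r ≠ 0 := by
    rintro rfl
    rw [add_zero] at hg
    exact hg (Ideal.mem_span_singleton'.2 ⟨s, rfl⟩)
  have hrI : r ∈ Ideal.span {q} := by
    have := Ideal.sub_mem _ hgI (Ideal.mul_mem_left _ s hI)
    rwa [add_sub_cancel_left] at this
  have hqr := degree_le_of_mem_span hr0 hrI
  have hq0 : q ≠ 0 := by
    rintro rfl
    rw [Ideal.mem_span_singleton'] at hrI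
    obtain ⟨b, hb⟩ := hrI
    exact hr0 (by rw [← hb, mul_zero])
  obtain ⟨k, hk⟩ := exists_degree_eq hq0
  have hkn : k < n := by
    have := hqr.trans_lt hr
    rw [hk, hdeg] at this
    exact_mod_cast this
  have hk' := degree_eq_iff.1 hk
  obtain ⟨q', hq'⟩ : ∃ q', q' = C (q.coeff k)⁻¹ * q := ⟨_, rfl⟩
  have hq'I : q' ∈ Ideal.span {q} := Ideal.mem_span_singleton'.2 ⟨_, hq'.symm⟩
  have hq'k : q'.coeff k = 1 := by rw [hq', coeff_C_mul, inv_mul_cancel₀ hk'.1]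
  have hq'z : ∀ i, k < i → q'.coeff i = 0 := fun i hi => by
    rw [hq', coeff_C_mul, hk'.2 i hi, mul_zero]
  -- The difference lies in the ideal and has degree below that of its generator, so it vanishes.
  have hcomm : ∀ y, q' * C y = C (σ^[k] y) * q' := by
    intro y
    rw [← sub_eq_zero]
    by_contra hne
    have h1 := degree_le_of_mem_span hne (Ideal.sub_mem _ (Ideal.mul_mem_right (C y) _ hq'I)
      (Ideal.mul_mem_left _ (C (σ^[k] y)) hq'I))
    rw [hk] at h1
    refine absurd h1 (not_le.2 (degree_lt_iff.2 fun i hi => ?_))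
    rw [coeff_sub, coeff_mul_C, coeff_C_mul, H.phi_iterate]
    rcases hi.eq_or_lt with rfl | hi
    · rw [hq'k, one_mul, mul_one, sub_self]
    · rw [hq'z i hi, zero_mul, mul_zero, sub_zero]
  -- A nonzero lower coefficient would make a power of `σ` below `n` inner. Hence `tⁿ`, and with it
  -- the unit `a`, lies in the ideal.
  have hX : q' = X ^ k := by
    ext i
    rw [X_pow_eq_monomial, coeff_monomial]
    rcases lt_trichotomy i k with h | rfl | h
    · rw [if_neg h.ne']
      refine H.eq_zero_of_intertwines h hkn fun y => ?_
      have := congrArg (fun p => p.coeff i) (hcomm y)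
      simpa only [coeff_mul_C, coeff_C_mul, H.phi_iterate] using this
    · rw [if_pos rfl, hq'k]
    · rw [if_neg h.ne, hq'z i h]
  have hXn : X ^ n ∈ Ideal.span {q} := by
    rw [← Nat.sub_add_cancel hkn.le, pow_add, ← hX]
    exact Ideal.mul_mem_left _ _ hq'I
  have haI : C a ∈ Ideal.span {q} := by
    have := Ideal.sub_mem _ (Ideal.mul_mem_left _ (C ((u⁻¹ : Dˣ) : D)) hXn) hI
    rwa [centralBinomial, centralVar, sub_sub_cancel] at this
  have := Ideal.mul_mem_left _ (C a⁻¹) haI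
  rwa [← C_mul, inv_mul_cancel₀ ha0, C_1] at this

/-- The annihilator of `R / R p` is a two-sided ideal containing `h_a`. It omits `1`, so by
maximality it is no larger than `R h_a`. -/
theorem mem_span_of_annihilates (H : IsInnerTwist σ u n) (hn : 0 < n) {a : D} (ha0 : a ≠ 0)
    (ha : IsFixedCentral σ a) {p g : SkewPolynomial D}
    (hp : centralBinomial u n a ∈ Ideal.span {p}) (hp1 : 1 ∉ Ideal.span {p})
    (hg : ∀ r, g * r ∈ Ideal.span {p}) : g ∈ Ideal.span {centralBinomial u n a} := by
  let I : Ideal (SkewPolynomial D) :=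
    { carrier := {g | ∀ r, g * r ∈ Ideal.span {p}}
      add_mem' := fun {x y} hx hy r => by
        rw [add_mul]
        exact Ideal.add_mem _ (hx r) (hy r)
      zero_mem' := fun r => by
        rw [zero_mul]
        exact zero_mem _
      smul_mem' := fun c x hx r => by
        rw [smul_eq_mul, mul_assoc]
        exact Ideal.mul_mem_left _ c (hx r) }
  have hI : I.IsTwoSided := ⟨fun {x} b hx r => by
    rw [mul_assoc]
    exact hx (b * r)⟩
  by_contra hcon
  have h1 : (1 : SkewPolynomial D) ∈ I := by
    refine H.one_mem_of_not_le hn ha0 I (fun r => ?_) fun hle => hcon (hle hg)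
    rw [H.centralBinomial_mul ha]
    exact Ideal.mul_mem_left _ r hp
  exact hp1 (by simpa using h1 1)

/-- The simple modules of `D[t;σ]` annihilated by `u⁻¹ t ^ n - a` are all isomorphic to `R / R p`,
so that their dimension `e` over `D` divides the dimension of every submodule of
`R / R (u⁻¹ t ^ n - a)`. -/
theorem dvd_sub_degree (H : IsInnerTwist σ u n) (hn : 0 < n) {a : D}
    (ha0 : a ≠ 0) (ha : IsFixedCentral σ a) {p : SkewPolynomial D} {e : ℕ} (he0 : 0 < e)
    (hpe : degree p = e) (hp : centralBinomial u n a ∈ Ideal.span {p})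
    (hmin : ∀ s : SkewPolynomial D, centralBinomial u n a ∈ Ideal.span {s} → ∀ l : ℕ,
      degree s = l → 0 < l → e ≤ l) (q : SkewPolynomial D) (l : ℕ) (hl : degree q = l)
    (hq : centralBinomial u n a ∈ Ideal.span {q}) : e ∣ n - l := by
  have hdeg := degree_centralBinomial u hn a
  have hcomm := H.centralBinomial_mul ha
  have hann := fun g => H.mem_span_of_annihilates hn ha0 ha (g := g) hp
  generalize centralBinomial u n a = h at *
  have h0 : h ≠ 0 := ne_zero_of_degree_eq hdeg
  have hp0 : p ≠ 0 := ne_zero_of_degree_eq hpe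
  have hp1 : (1 : SkewPolynomial D) ∉ Ideal.span {p} := fun h1 => by
    have := degree_le_of_mem_span one_ne_zero h1
    rw [hpe, ← C_1, degree_C one_ne_zero, Nat.cast_le] at this
    omega
  obtain ⟨j, hj⟩ : ∃ j, n - l = j := ⟨_, rfl⟩
  induction j using Nat.strong_induction_on generalizing q l with
  | _ j ih =>
    by_cases hqh : q ∈ Ideal.span {h}
    · have := degree_le_of_mem_span (ne_zero_of_degree_eq hl) hqh
      rw [hdeg, hl, Nat.cast_le] at this
      rw [Nat.sub_eq_zero_of_le this]
      exact dvd_zero e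
    · have hw : ∃ w, q * w ∉ Ideal.span {p} := by
        by_contra! hw
        exact hqh (hann q hp1 hw)
      obtain ⟨w, hw⟩ := hw
      -- `J = R s` is the annihilator of the nonzero class of `q w` in `R / R p`. Minimality of `e`
      -- gives `deg s ≥ e`, and the Ore bound gives `deg s ≤ e`.
      obtain ⟨J, hJ⟩ : ∃ J : Ideal (SkewPolynomial D),
          ∀ s, s ∈ J ↔ s * (q * w) ∈ Ideal.span {p} :=
        ⟨Submodule.comap (LinearMap.toSpanSingleton (SkewPolynomial D) (SkewPolynomial D) (q * w))
          (Ideal.span {p}), fun s => Iff.rfl⟩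
      obtain ⟨s, hs⟩ := exists_eq_span J
      have hhJ : h ∈ Ideal.span {s} := by
        rw [← hs, hJ, hcomm]
        exact Ideal.mul_mem_left _ _ hp
      have hs0 : s ≠ 0 := by
        rintro rfl
        obtain ⟨x, hx⟩ := Ideal.mem_span_singleton'.1 hhJ
        exact h0 (by rw [← hx, mul_zero])
      obtain ⟨i, hi⟩ := exists_degree_eq hs0
      have hi0 : 0 < i := by
        rw [Nat.pos_iff_ne_zero]
        rintro rfl
        have h1 : (1 : SkewPolynomial D) ∈ J := by
          rw [hs, Ideal.mem_span_singleton']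
          exact (isUnit_iff_degree.2 hi).exists_left_inv
        rw [hJ, one_mul] at h1
        exact hw h1
      have hei : e ≤ i := hmin s hhJ i hi hi0
      have hie : i ≤ e := by
        obtain ⟨s', hs'0, hs'd, hs'⟩ := exists_mul_mem_span hp0 (q * w)
        have h1 : s' ∈ Ideal.span {s} := by rwa [← hs, hJ]
        have := (degree_le_of_mem_span hs'0 h1).trans hs'd
        rwa [hi, hpe, Nat.cast_le] at this
      obtain rfl : i = e := le_antisymm hie hei
      have hsq : degree (s * q) = ((i + l : ℕ) : WithBot ℕ) := degree_mul_of_eq hi hl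
      -- If `h = x q`, then `x q w = h w = w h`-type centrality puts `x` in `J = R s`. The induction
      -- continues with `s q`, of degree `e + l`.
      have hhsq : h ∈ Ideal.span {s * q} := by
        obtain ⟨x, hx⟩ := Ideal.mem_span_singleton'.1 hq
        have hxJ : x ∈ Ideal.span {s} := by
          rw [← hs, hJ, ← mul_assoc, hx, hcomm]
          exact Ideal.mul_mem_left _ _ hp
        obtain ⟨y, rfl⟩ := Ideal.mem_span_singleton'.1 hxJ
        exact Ideal.mem_span_singleton'.2 ⟨y, by rw [← mul_assoc, hx]⟩
      have hle := degree_le_of_mem_span h0 hhsq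
      rw [hsq, hdeg, Nat.cast_le] at hle
      have := ih (n - (i + l)) (by omega) _ _ hsq hhsq rfl
      have e1 : n - l = (n - (i + l)) + i := by omega
      rw [e1]
      exact dvd_add this dvd_rfl

/-- `dvd_sub_degree` with `q = 1` shows that the least positive degree of a right divisor divides
the prime `n`. It is at most `k < n`, so it is `1`. -/
theorem exists_X_sub_C_of_proper_divisor (H : IsInnerTwist σ u n) (hn : n.Prime) {a : D}
    (ha0 : a ≠ 0) (ha : IsFixedCentral σ a) {q : SkewPolynomial D} {k : ℕ} (hk : degree q = k)
    (hk0 : 0 < k) (hkn : k < n) (hq : centralBinomial u n a ∈ Ideal.span {q}) :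
    ∃ b, centralBinomial u n a ∈ Ideal.span {X - C b} := by
  classical
  have hex : ∃ e : ℕ, 0 < e ∧ ∃ p, degree p = e ∧ centralBinomial u n a ∈ Ideal.span {p} :=
    ⟨k, hk0, q, hk, hq⟩
  obtain ⟨he0, p, hpe, hp⟩ := Nat.find_spec hex
  have hmin : ∀ s : SkewPolynomial D, centralBinomial u n a ∈ Ideal.span {s} → ∀ l : ℕ,
      degree s = l → 0 < l → Nat.find hex ≤ l :=
    fun s hs l hl hl0 => Nat.find_min' hex ⟨hl0, s, hl, hs⟩
  have hen := hmin q hq k hk hk0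
  have hdvd := H.dvd_sub_degree hn.pos ha0 ha he0 hpe hp hmin 1 0
    (by rw [← C_1, degree_C one_ne_zero]) (Ideal.mem_span_singleton'.2 ⟨_, mul_one _⟩)
  have he1 : Nat.find hex = 1 := by
    rcases (Nat.dvd_prime hn).1 hdvd with h1 | h1
    · exact h1
    · omega
  rw [he1] at hpe
  have hp' := degree_eq_iff.1 hpe
  refine ⟨-((p.coeff 1)⁻¹ * p.coeff 0), ?_⟩
  have hpX : C (p.coeff 1) * (X - C (-((p.coeff 1)⁻¹ * p.coeff 0))) = p := by
    ext i
    rw [coeff_C_mul, coeff_sub, C_neg, coeff_neg, sub_neg_eq_add]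
    rcases i with _ | _ | i
    · rw [coeff_X_zero, zero_add, coeff_C_zero, mul_inv_cancel_left₀ hp'.1]
    · simp
    · rw [coeff_X_of_ne_one (by omega), coeff_C_succ, hp'.2 (i + 1 + 1) (by omega), add_zero, mul_zero]
  obtain ⟨x, hx⟩ := Ideal.mem_span_singleton'.1 hp
  exact Ideal.mem_span_singleton'.2 ⟨x * C (p.coeff 1), by rw [mul_assoc, hpX, hx]⟩

/-- Modulo `R(t - b)`, `t N = σ(N) t ≡ σ(N) b`, which is the recursion of the norm. -/
theorem X_pow_sub_skewNorm_mem (H : IsInnerTwist σ u n) (b : D) (k : ℕ) :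
    X ^ k - C (skewNorm σ k b) ∈ Ideal.span {X - C b} := by
  induction k with
  | zero => simp [skewNorm, C_1]
  | succ k ih =>
    have e : X ^ (k + 1) - C (skewNorm σ (k + 1) b) =
        X * (X ^ k - C (skewNorm σ k b)) + C (σ (skewNorm σ k b)) * (X - C b) := by
      rw [skewNorm_succ, mul_sub, mul_sub, X_mul_C, H.twist, C_mul, pow_succ']
      abel
    rw [e]
    exact Ideal.add_mem _ (Ideal.mul_mem_left _ _ ih)
      (Ideal.mul_mem_left _ _ (Ideal.mem_span_singleton_self _))

theorem mem_span_X_sub_C_iff (H : IsInnerTwist σ u n) (a b : D) :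
    centralBinomial u n a ∈ Ideal.span {X - C b} ↔ (u : D) * a = skewNorm σ n b := by
  have hN := H.X_pow_sub_skewNorm_mem b n
  constructor
  · intro h
    have h1 := Ideal.sub_mem _ hN (Ideal.mul_mem_left _ (C (u : D)) h)
    rw [C_mul_centralBinomial, sub_sub_sub_cancel_left, ← C_sub] at h1
    by_contra hne
    have hne' := sub_ne_zero.2 hne
    have h2 := degree_le_of_mem_span (mt C_eq_zero.1 hne') h1
    rw [degree_X_sub_C, degree_C hne', Nat.cast_le] at h2
    omega
  · intro h
    rw [centralBinomial_eq_C_mul, h]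
    exact Ideal.mul_mem_left _ _ hN

/-- Shows that `t - Ω_c(b)` annihilates the class of `c` in `R / R(t - b)`; this is how `Ω` enters.
-/
theorem X_sub_C_Omega_mul (H : IsInnerTwist σ u n) (c : Dˣ) (b : D) :
    (X - C (Omega σ c b)) * C (c : D) = C (σ c) * (X - C b) := by
  rw [sub_mul, mul_sub, X_mul_C, H.twist, ← C_mul, ← C_mul, Omega, mul_assoc _ _ (c : D),
    Units.inv_mul, mul_one]

/-- Otherwise `f` acts injectively on `R / R(t - b)`. Writing `h_a = f g`, the factor `g` kills this
module, so `g ∈ R h_a` by faithfulness, although `deg g = n - m < n`. -/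
theorem exists_mem_span_X_sub_C_Omega (H : IsInnerTwist σ u n) (hn : 0 < n) {a : D}
    (ha0 : a ≠ 0) (ha : IsFixedCentral σ a) {b : D}
    (hb : centralBinomial u n a ∈ Ideal.span {X - C b}) {f : SkewPolynomial D} {m : ℕ}
    (hm : 0 < m) (hf : degree f = m) (hfh : centralBinomial u n a ∈ Ideal.span {f}) :
    ∃ c : Dˣ, f ∈ Ideal.span {X - C (Omega σ c b)} := by
  have hdeg := degree_centralBinomial u hn a
  have h0 := ne_zero_of_degree_eq hdeg
  by_contra! hcon
  have hinj : ∀ r, f * r ∈ Ideal.span {X - C b} → r ∈ Ideal.span {X - C b} := by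
    intro r hr
    obtain ⟨s, w, rfl, hw⟩ := exists_eq_mul_add (ne_zero_of_degree_eq (degree_X_sub_C b)) r
    rw [degree_X_sub_C] at hw
    rw [eq_C_of_degree_lt_one hw] at hr ⊢
    by_cases hc : w.coeff 0 = 0
    · rw [hc, C_0, add_zero]
      exact Ideal.mem_span_singleton'.2 ⟨s, rfl⟩
    · exfalso
      -- With `c` the remainder of `r`, `f c = x(t - b) = x σ(c)⁻¹ (t - Ω_c(b)) c`, and `c` cancels.
      refine hcon (Units.mk0 _ hc) ?_
      have h1 := Ideal.sub_mem _ hr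
        (Ideal.mul_mem_left _ (f * s) (Ideal.mem_span_singleton_self (X - C b)))
      rw [mul_add, ← mul_assoc, add_sub_cancel_left] at h1
      obtain ⟨x, hx⟩ := Ideal.mem_span_singleton'.1 h1
      have h2 := H.X_sub_C_Omega_mul (Units.mk0 _ hc) b
      have hσc : σ (w.coeff 0) ≠ 0 := by rwa [map_ne_zero_iff _ σ.injective]
      refine Ideal.mem_span_singleton'.2 ⟨x * C (σ (w.coeff 0))⁻¹, ?_⟩
      refine mul_right_cancel₀ (mt C_eq_zero.1 hc) ?_
      rw [Units.val_mk0] at h2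
      rw [mul_assoc, h2, mul_assoc, ← mul_assoc _ (C (σ (w.coeff 0))), ← C_mul,
        inv_mul_cancel₀ hσc, C_1, one_mul, hx]
  obtain ⟨g, hg⟩ := Ideal.mem_span_singleton'.1 hfh
  have hfg := eq_mul_of_central_eq_mul (H.centralBinomial_mul ha) h0 hg.symm
  have hgV : ∀ r, g * r ∈ Ideal.span {X - C b} := fun r => hinj _ (by
    rw [← mul_assoc, ← hfg, H.centralBinomial_mul ha]
    exact Ideal.mul_mem_left _ _ hb)
  have h1 : (1 : SkewPolynomial D) ∉ Ideal.span {X - C b} := fun h1 => by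
    have := degree_le_of_mem_span one_ne_zero h1
    rw [degree_X_sub_C, ← C_1, degree_C one_ne_zero, Nat.cast_le] at this
    omega
  have hgh := H.mem_span_of_annihilates hn ha0 ha hb h1 hgV
  have hg0 : g ≠ 0 := by
    rintro rfl
    exact h0 (by rw [hfg, mul_zero])
  obtain ⟨k, hk⟩ := exists_degree_eq hg0
  have h2 := degree_le_of_mem_span hg0 hgh
  have h3 := degree_mul_of_eq hk hf
  rw [hg, hdeg, Nat.cast_inj] at h3
  rw [hdeg, hk, Nat.cast_le] at h2
  omega

theorem exists_eq_prod_X_sub_C_Omega (H : IsInnerTwist σ u n) (hn : 0 < n) {a : D}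
    (ha0 : a ≠ 0) (ha : IsFixedCentral σ a) {b : D}
    (hb : centralBinomial u n a ∈ Ideal.span {X - C b}) (m : ℕ) (f : SkewPolynomial D)
    (hf : degree f = m) (hf1 : f.coeff m = 1)
    (hfh : centralBinomial u n a ∈ Ideal.span {f}) :
    ∃ c : ℕ → Dˣ, f = ((List.range' 1 m).map fun i => X - C (Omega σ (c i) b)).prod := by
  have h0 := ne_zero_of_degree_eq (degree_centralBinomial u hn a)
  induction m generalizing f with
  | zero =>
    refine ⟨fun _ => 1, ?_⟩
    rw [eq_C_of_degree_lt_one (p := f) (by rw [hf]; exact_mod_cast Nat.zero_lt_one), hf1, C_1]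
    rfl
  | succ m ih =>
    obtain ⟨c, hc⟩ := H.exists_mem_span_X_sub_C_Omega hn ha0 ha hb m.succ_pos hf hfh
    obtain ⟨f', rfl⟩ := Ideal.mem_span_singleton'.1 hc
    obtain ⟨k, hk⟩ := exists_degree_eq (left_ne_zero_of_mul (ne_zero_of_degree_eq hf))
    have hX := degree_X_sub_C (Omega σ c b)
    have hkm := degree_mul_of_eq hk hX
    rw [hf, Nat.cast_inj] at hkm
    obtain rfl : m = k := by omega
    rw [coeff_mul_add_of_degree_le hk.le hX.le, coeff_X_sub_C_one, iterate_map_one, mul_one] at hf1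
    obtain ⟨c', hc'⟩ := ih f' hk hf1 (central_mem_span_left (H.centralBinomial_mul ha) h0 hfh)
    -- The factor split off on the right takes the last index of `List.range' 1 (m + 1)`.
    refine ⟨Function.update c' (1 + m) c, ?_⟩
    rw [List.range'_1_concat, List.map_append, List.prod_append, List.map_singleton,
      List.prod_singleton, Function.update_self]
    congr 1
    rw [hc']
    congr 1
    refine List.map_congr_left fun i hi => ?_
    rw [List.mem_range'_1] at hi
    rw [Function.update_of_ne (by omega)]

end IsInnerTwist

/-- In `g f` the lowest nonzero coefficient sits at the order of `g`, at most `deg g`, and the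
highest at `deg g + m`. So `g f` is not a monomial. -/
theorem X_pow_notMem_span {f : SkewPolynomial D} {m : ℕ} (hm : 0 < m) (hf : degree f = m)
    (hf0 : f.coeff 0 ≠ 0) (k : ℕ) : X ^ k ∉ Ideal.span {f} := by
  classical
  intro h
  obtain ⟨g, hg⟩ := Ideal.mem_span_singleton'.1 h
  have hg0 : g ≠ 0 := by
    rintro rfl
    have := congrArg (fun p => p.coeff k) hg
    simp [X_pow_eq_monomial, coeff_monomial] at this
  have hex : ∃ j, g.coeff j ≠ 0 := by
    by_contra! hj
    exact hg0 (SkewPolynomial.ext hj)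
  have hmin : ∀ i < Nat.find hex, g.coeff i = 0 := fun i hi => by
    simpa using Nat.find_min hex hi
  have hj := Nat.find_spec hex
  set j := Nat.find hex
  have hco : (g * f).coeff j = g.coeff j * φ^[j] (f.coeff 0) := by
    rw [coeff_mul_antidiagonal, Finset.sum_eq_single (j, 0)]
    · rintro ⟨x, y⟩ hxy hne
      rw [Finset.HasAntidiagonal.mem_antidiagonal] at hxy
      dsimp only at hxy ⊢
      rcases Nat.eq_zero_or_pos y with rfl | hy
      · exact absurd (by rw [← hxy, add_zero]) hne
      · rw [hmin x (by omega), zero_mul]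
    · intro h
      exact absurd (Finset.HasAntidiagonal.mem_antidiagonal.2 (by rfl)) h
  have hne : (g * f).coeff j ≠ 0 := by
    rw [hco]
    exact mul_ne_zero hj (mt phi_iterate_eq_zero.1 hf0)
  obtain ⟨l, hl⟩ := exists_degree_eq hg0
  have hgf := degree_eq_iff.1 (degree_mul_of_eq hl hf)
  have hjl : j ≤ l := not_lt.1 fun hlj => hj ((degree_eq_iff.1 hl).2 j hlj)
  rw [hg, X_pow_eq_monomial, coeff_monomial] at hne hgf
  have h1 : k = j := by
    by_contra hkj
    exact hne (if_neg hkj)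
  have h2 : k = l + m := by
    by_contra hkl
    exact hgf.1 (if_neg hkl)
  omega

theorem RightCoprime.coeff_zero_ne_zero {f : SkewPolynomial D} (h : RightCoprime f X) :
    f.coeff 0 ≠ 0 := by
  intro h0
  obtain ⟨s, r, hsr, hr⟩ := exists_eq_mul_add (X_ne_zero (R := D)) f
  have hX : degree (X : SkewPolynomial D) = (1 : ℕ) := degree_monomial one_ne_zero
  rw [hX] at hr
  have hr0 : r = 0 := by
    have := congrArg (fun p => p.coeff 0) hsr
    simp only [coeff_add, coeff_mul_zero, coeff_X_zero, mul_zero, zero_add, h0] at this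
    rw [eq_C_of_degree_lt_one hr, ← this, C_0]
  rw [hr0, add_zero] at hsr
  have hu := isUnit_iff_degree.1 (h X ⟨s, hsr⟩ ⟨1, (one_mul X).symm⟩)
  rw [hX, Nat.cast_inj] at hu
  omega

end InnerTwist

/-! ### Eigenrings as corners of central simple algebras -/

section CentralSimple

theorem exists_sum_mul_mul_eq_one {S : Type*} [Ring S] [IsSimpleRing S] {c : S} (hc : c ≠ 0) :
    ∃ l : List (S × S), (l.map fun x => x.1 * c * x.2).sum = 1 := by
  let I : TwoSidedIdeal S := .mk' {s | ∃ l : List (S × S), (l.map fun x => x.1 * c * x.2).sum = s}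
    ⟨[], rfl⟩
    (by
      rintro _ _ ⟨l, rfl⟩ ⟨l', rfl⟩
      exact ⟨l ++ l', by rw [List.map_append, List.sum_append]⟩)
    (by
      rintro _ ⟨l, rfl⟩
      refine ⟨l.map fun x => (-x.1, x.2), ?_⟩
      rw [List.map_map, ← neg_one_mul (List.sum _), ← List.sum_map_mul_left]
      simp [Function.comp_def])
    (by
      rintro s _ ⟨l, rfl⟩
      refine ⟨l.map fun x => (s * x.1, x.2), ?_⟩
      rw [List.map_map, ← List.sum_map_mul_left]
      simp [Function.comp_def, mul_assoc])
    (by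
      rintro _ s ⟨l, rfl⟩
      refine ⟨l.map fun x => (x.1, x.2 * s), ?_⟩
      rw [List.map_map, ← List.sum_map_mul_right]
      simp [Function.comp_def, mul_assoc])
  have hcI : c ∈ I := by
    rw [TwoSidedIdeal.mem_mk']
    exact ⟨[(1, 1)], by simp⟩
  have h1 := IsSimpleRing.one_mem_of_ne_zero_mem I hc hcI
  rwa [TwoSidedIdeal.mem_mk'] at h1

variable {K R S : Type*} [Field K] [Ring R] [Algebra K R] [Ring S] [Algebra K S]

/-- If `R f` contains the kernel of a surjection of `R` onto a finite-dimensional central simple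
algebra `S`, then the eigenring of `f` is isomorphic to a corner ring of `S`, and is therefore
central simple too. -/
theorem isCentralSimpleAlgebra_eigenring (hS : IsCentralSimpleAlgebra K S) (π : R →ₐ[K] S)
    (hπ : Function.Surjective π) {f : R} (hker : ∀ r, π r = 0 → r ∈ Ideal.span {f})
    (hf : 1 ∉ Ideal.span {f}) : IsCentralSimpleAlgebra K (Eigenring K f) := by
  obtain ⟨hcentral, hsimple, hfin⟩ := hS
  have : IsArtinianRing S := IsArtinianRing.of_finite K S
  have : IsSemisimpleRing S := IsSimpleRing.isSemisimpleRing_iff_isArtinianRing.2 this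
  -- The image of `R f` is `S e'`. With `e = 1 - e'`, `r ∈ R f` iff `π(r) e = 0`, and `g ↦ π(g) e`
  -- identifies the eigenring with `eSe`.
  obtain ⟨e', he', hspan⟩ := IsSemisimpleRing.ideal_eq_span_idempotent (Ideal.span {π f})
  obtain ⟨e, he⟩ : ∃ e, e = 1 - e' := ⟨_, rfl⟩
  have hee : e * e = e := by rw [he]; exact he'.one_sub.eq
  have he'e : e' * e = 0 := by rw [he, mul_sub, mul_one, he'.eq, sub_self]
  have hmem : ∀ r, r ∈ Ideal.span {f} ↔ π r * e = 0 := by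
    intro r
    have h1 : r ∈ Ideal.span {f} ↔ π r ∈ Ideal.span {π f} := by
      constructor
      · intro h
        obtain ⟨x, rfl⟩ := Ideal.mem_span_singleton'.1 h
        exact Ideal.mem_span_singleton'.2 ⟨π x, (map_mul π x f).symm⟩
      · intro h
        obtain ⟨y, hy⟩ := Ideal.mem_span_singleton'.1 h
        obtain ⟨x, rfl⟩ := hπ y
        have h2 := hker (r - x * f) (by rw [map_sub, map_mul, hy, sub_self])
        have h3 := Ideal.add_mem _ h2 (Ideal.mul_mem_left _ x (Ideal.mem_span_singleton_self f))
        rwa [sub_add_cancel] at h3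
    rw [h1, hspan]
    constructor
    · intro h
      obtain ⟨y, hy⟩ := Ideal.mem_span_singleton'.1 h
      rw [← hy, mul_assoc, he'e, mul_zero]
    · intro h
      rw [he, mul_sub, mul_one, sub_eq_zero] at h
      exact Ideal.mem_span_singleton'.2 ⟨π r, h.symm⟩
  have he0 : e ≠ 0 := fun h => hf ((hmem 1).2 (by rw [h, mul_zero]))
  have hfe : π f * e = 0 := (hmem f).1 (Ideal.mem_span_singleton_self f)
  have hid : ∀ g, g ∈ idealiser K f ↔ e * π g * e = π g * e := by
    intro g
    have h1 : g ∈ idealiser K f ↔ f * g ∈ Ideal.span {f} := Iff.rfl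
    rw [h1, hmem, map_mul]
    have h2 : e' ∈ Ideal.span {π f} := hspan ▸ Ideal.mem_span_singleton_self e'
    obtain ⟨y, hy⟩ := Ideal.mem_span_singleton'.1 h2
    constructor
    · intro h
      rw [he, sub_mul, one_mul, ← he, sub_mul, ← hy, mul_assoc y, mul_assoc y, h, mul_zero,
        sub_zero]
    · intro h
      rw [mul_assoc, ← h, mul_assoc, ← mul_assoc, hfe, zero_mul]
  have hlift : ∀ s, ∃ g : idealiser K f, π g = e * s * e := by
    intro s
    obtain ⟨g, hg⟩ := hπ (e * s * e)
    refine ⟨⟨g, (hid g).2 ?_⟩, hg⟩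
    rw [hg, ← mul_assoc, ← mul_assoc, hee]
  have hmk : ∀ g : idealiser K f, Ideal.Quotient.mk (eigenIdeal K f) g = 0 ↔ π g * e = 0 :=
    fun g => Ideal.Quotient.eq_zero_iff_mem.trans (hmem g)
  refine ⟨⟨fun c hc => ?_⟩, ?_, ?_⟩
  · obtain ⟨g, rfl⟩ := Ideal.Quotient.mk_surjective c
    rw [Subalgebra.mem_center_iff] at hc
    have hcomm : ∀ s, e * s * e * (π g * e) = π g * e * (e * s * e) := by
      intro s
      obtain ⟨y, hy⟩ := hlift s
      have h1 := hc (Ideal.Quotient.mk _ y)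
      rw [← map_mul, ← map_mul, ← sub_eq_zero, ← map_sub, hmk] at h1
      have h2 : π (y : R) * π (g : R) * e = π (g : R) * π (y : R) * e := by
        rw [← sub_eq_zero, ← sub_mul, ← map_mul, ← map_mul, ← map_sub]
        exact h1
      rw [hy] at h2
      have h3 := (hid g).1 g.2
      calc e * s * e * (π g * e) = e * s * e * π g * e := by rw [mul_assoc (e * s * e)]
        _ = π g * (e * s * e) * e := h2
        _ = π g * (e * s * e) := by rw [mul_assoc (π (g : R)), mul_assoc (e * s), hee]
        _ = π g * e * (e * s * e) := by simp only [← mul_assoc, mul_assoc (π (g : R)) e e, hee]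
    -- Let `c = π(g) e` be central in `eSe` and `1 = ∑ xᵢ e yᵢ`. Then `z = ∑ xᵢ c yᵢ` is central in
    -- `S` and `z e = c`. Both follow by inserting this expression for `1` and moving `c` across
    -- elements of `eSe`. So `z`, and with it the class of `g`, is a scalar.
    obtain ⟨l, hl⟩ := exists_sum_mul_mul_eq_one he0
    have hge : e * (π g * e) = π g * e := by rw [← mul_assoc]; exact (hid g).1 g.2
    obtain ⟨z, hz⟩ : ∃ z, z = (l.map fun x => x.1 * (π g * e) * x.2).sum := ⟨_, rfl⟩
    have hzs : ∀ s x, x ∈ l → x.1 * (π g * e) * x.2 * s =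
        (l.map fun x' => x.1 * e * x.2 * s * x'.1 * (π g * e) * x'.2).sum := by
      intro s x _
      have h1 : x.1 * (π g * e) * x.2 * s =
          x.1 * (π g * e) * x.2 * s * (l.map fun x => x.1 * e * x.2).sum := by rw [hl, mul_one]
      rw [h1, ← List.sum_map_mul_left]
      congr 1
      refine List.map_congr_left fun x' _ => ?_
      have h2 := hcomm (x.2 * s * x'.1)
      have h3 : π g * e * (e * (x.2 * s * x'.1) * e) = π g * e * (x.2 * s * x'.1) * e := by
        simp only [← mul_assoc, mul_assoc (π (g : R)) e e, hee]
      have h4 : e * (x.2 * s * x'.1) * e * (π g * e) = e * (x.2 * s * x'.1) * (π g * e) := by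
        rw [mul_assoc _ e (π (g : R) * e), hge]
      rw [h3, h4] at h2
      calc x.1 * (π g * e) * x.2 * s * (x'.1 * e * x'.2)
          = x.1 * (π g * e * (x.2 * s * x'.1) * e) * x'.2 := by simp only [mul_assoc]
        _ = x.1 * (e * (x.2 * s * x'.1) * (π g * e)) * x'.2 := by rw [h2]
        _ = _ := by simp only [mul_assoc]
    have hzc : z ∈ Subalgebra.center K S := by
      rw [Subalgebra.mem_center_iff]
      intro s
      have h1 : z * s = (l.map fun x => x.1 * e * x.2 * (s * z)).sum := by
        rw [hz, ← List.sum_map_mul_right]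
        congr 1
        refine List.map_congr_left fun x hx => ?_
        rw [hzs s x hx, ← List.sum_map_mul_left, ← List.sum_map_mul_left]
        congr 1
        refine List.map_congr_left fun x' _ => ?_
        simp only [mul_assoc]
      rw [h1, List.sum_map_mul_right, hl, one_mul]
    obtain ⟨k, hk⟩ := Algebra.mem_bot.1 (hcentral.out hzc)
    have hze : z * e = π g * e := by
      have h1 : π g * e = (l.map fun x => x.1 * e * x.2).sum * (π g * e) := by rw [hl, one_mul]
      rw [h1, hz, ← List.sum_map_mul_right, ← List.sum_map_mul_right]
      congr 1
      refine List.map_congr_left fun x _ => ?_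
      have h2 := hcomm x.2
      have h3 : π g * e * (e * x.2 * e) = π g * e * x.2 * e := by
        simp only [← mul_assoc, mul_assoc (π (g : R)) e e, hee]
      have h4 : e * x.2 * e * (π g * e) = e * x.2 * (π g * e) := by
        rw [mul_assoc _ e (π (g : R) * e), hge]
      rw [h3, h4] at h2
      calc x.1 * (π g * e) * x.2 * e = x.1 * (π g * e * x.2 * e) := by simp only [mul_assoc]
        _ = x.1 * (e * x.2 * (π g * e)) := by rw [h2]
        _ = _ := by simp only [mul_assoc]
    rw [Algebra.mem_bot]
    refine ⟨k, ?_⟩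
    have h1 : algebraMap K (Eigenring K f) k =
        Ideal.Quotient.mk (eigenIdeal K f) (algebraMap K (idealiser K f) k) := rfl
    rw [h1, ← sub_eq_zero, ← map_sub, hmk]
    have h2 : ((algebraMap K (idealiser K f) k - g : idealiser K f) : R) =
        algebraMap K R k - g := rfl
    rw [h2, map_sub, AlgHom.commutes, sub_mul, hk, hze, sub_self]
  · rw [isSimpleRing_iff_isTwoSided_imp]
    refine ⟨⟨0, 1, fun h => ?_⟩, fun I hI => ?_⟩
    · have h1 := (hmk 1).1 ((map_one _).trans h.symm)
      rw [OneMemClass.coe_one, map_one, one_mul] at h1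
      exact he0 h1
    · rw [or_iff_not_imp_left]
      intro hne
      obtain ⟨c, hcI, hc0⟩ := Submodule.exists_mem_ne_zero_of_ne_bot hne
      obtain ⟨g, rfl⟩ := Ideal.Quotient.mk_surjective c
      rw [Ne, hmk] at hc0
      -- Multiplying `∑ xᵢ π(g) e yᵢ = 1` by `e` on both sides writes `e`, the identity of the
      -- corner, with coefficients `e xᵢ e` and `e yᵢ e`, which lift to the idealiser.
      obtain ⟨l, hl⟩ := exists_sum_mul_mul_eq_one hc0
      choose lift hlift using hlift
      have hsum : Ideal.Quotient.mk (eigenIdeal K f)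
          (l.map fun x => lift x.1 * g * lift x.2).sum = 1 := by
        rw [← map_one (Ideal.Quotient.mk (eigenIdeal K f)), ← sub_eq_zero, ← map_sub, hmk]
        have hc : ((((l.map fun x => lift x.1 * g * lift x.2).sum - 1 : idealiser K f)) : R) =
            (l.map fun x => (lift x.1 : R) * g * lift x.2).sum - 1 := by
          have := map_list_sum (idealiser K f).val (l.map fun x => lift x.1 * g * lift x.2)
          rw [List.map_map] at this
          exact congrArg (· - 1) this
        rw [hc, map_sub, map_one, map_list_sum, List.map_map, sub_mul, one_mul, sub_eq_zero]
        have h1 : e = e * (l.map fun x => x.1 * (π g * e) * x.2).sum * e := by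
          rw [hl, mul_one, hee]
        conv_rhs => rw [h1]
        rw [← List.sum_map_mul_left, ← List.sum_map_mul_right, ← List.sum_map_mul_right]
        congr 1
        refine List.map_congr_left fun x _ => ?_
        have h3 : e * π g * e = π g * e := (hid g).1 g.2
        simp only [Function.comp_apply, map_mul, hlift]
        calc e * x.1 * e * π g * (e * x.2 * e) * e
            = e * x.1 * (e * π g * e) * x.2 * (e * e) := by simp only [mul_assoc]
          _ = _ := by rw [h3, hee]; simp only [mul_assoc]
      rw [Ideal.eq_top_iff_one, ← hsum, map_list_sum, List.map_map]
      refine list_sum_mem fun y hy => ?_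
      obtain ⟨x, _, rfl⟩ := List.mem_map.1 hy
      rw [Function.comp_apply, map_mul, map_mul]
      exact Ideal.mul_mem_right _ _ (Ideal.mul_mem_left _ _ hcI)
  · let θ : idealiser K f →ₗ[K] S :=
      (LinearMap.mulRight K e).comp (π.toLinearMap.comp (idealiser K f).val.toLinearMap)
    have hle : LinearMap.ker θ ≤
        LinearMap.ker (Ideal.Quotient.mkₐ K (eigenIdeal K f)).toLinearMap := by
      intro g hg
      exact (hmk g).2 hg
    have : FiniteDimensional K (idealiser K f ⧸ LinearMap.ker θ) :=
      Module.Finite.equiv θ.quotKerEquivRange.symm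
    refine Module.Finite.of_surjective ((LinearMap.ker θ).liftQ _ hle) ?_
    intro c
    obtain ⟨g, rfl⟩ := Ideal.Quotient.mk_surjective c
    exact ⟨Submodule.Quotient.mk g, rfl⟩

end CentralSimple

/-! ### The central simple algebra `R / R(u⁻¹tⁿ - a)` -/

section Quotient

theorem eq_sum_monomial_of_degree_lt {D : Type*} [DivisionRing D] {r : SkewPolynomial D} {n : ℕ} (hr : degree r < n) :
    r = ∑ i : Fin n, monomial i (r.coeff i) := by
  rw [Fin.sum_univ_eq_sum_range (fun i => monomial i (r.coeff i)) n]
  rw [← sum_eq_of_subset (fun i c => monomial i c) (fun i => monomial_zero_right i),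
    sum_monomial]
  intro i hi
  rw [Finset.mem_range]
  by_contra hni
  exact mem_support_iff.1 hi (degree_lt_iff.1 hr i (not_lt.1 hni))

variable {K D : Type*} [Field K] [DivisionRing D] [Algebra K D]
  [MulSemiringAction (Multiplicative ℕ) D] [SMulCommClass (Multiplicative ℕ) K D]
  {σ : D ≃+* D} {u : Dˣ} {n : ℕ}

theorem finiteDimensional_quotient [FiniteDimensional K D] {h : SkewPolynomial D}
    (hh : degree h = n) [(Ideal.span {h}).IsTwoSided] :
    FiniteDimensional K (SkewPolynomial D ⧸ Ideal.span {h}) := by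
  let ψ : (Fin n → D) →ₗ[K] SkewPolynomial D :=
    LinearMap.lsum K (fun _ => D) K fun i =>
      SkewMonoidAlgebra.lsingle K (Multiplicative.ofAdd (i : ℕ))
  have hψ : ∀ v, ψ v = ∑ i : Fin n, monomial i (v i) := fun v => by
    simp only [ψ, LinearMap.lsum_apply, LinearMap.sum_apply]
    rfl
  refine Module.Finite.of_surjective
    ((Ideal.Quotient.mkₐ K (Ideal.span {h})).toLinearMap.comp ψ) ?_
  intro c
  obtain ⟨g, rfl⟩ := Ideal.Quotient.mk_surjective c
  obtain ⟨s, r, rfl, hr⟩ := exists_eq_mul_add (ne_zero_of_degree_eq hh) g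
  rw [hh] at hr
  refine ⟨fun i => r.coeff i, ?_⟩
  rw [LinearMap.comp_apply, hψ, ← eq_sum_monomial_of_degree_lt hr]
  refine Ideal.Quotient.eq.2 ?_
  rw [sub_add_cancel_right]
  exact Ideal.neg_mem_iff _ |>.2 (Ideal.mem_span_singleton'.2 ⟨s, rfl⟩)

/-- The algebra `D[t;σ] / (u⁻¹ t ^ n - a)` is central simple. -/
theorem IsInnerTwist.isCentralSimpleAlgebra_quotient (H : IsInnerTwist σ u n) (hn : 2 ≤ n)
    [FiniteDimensional K D]
    (hK : ∀ x : D, IsFixedCentral σ x ↔ ∃ k : K, algebraMap K D k = x) {a : D} (ha0 : a ≠ 0)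
    [(Ideal.span {centralBinomial u n a}).IsTwoSided] :
    IsCentralSimpleAlgebra K (SkewPolynomial D ⧸ Ideal.span {centralBinomial u n a}) := by
  have hn0 : 0 < n := by omega
  have hdeg := degree_centralBinomial u hn0 a
  refine ⟨⟨fun c hc => ?_⟩, ?_, finiteDimensional_quotient hdeg⟩
  · obtain ⟨g, rfl⟩ := Ideal.Quotient.mk_surjective c
    obtain ⟨s, r, hsr, hr⟩ := exists_eq_mul_add (ne_zero_of_degree_eq hdeg) g
    have hgr : Ideal.Quotient.mk (Ideal.span {centralBinomial u n a}) g =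
        Ideal.Quotient.mk _ r := by
      refine Ideal.Quotient.eq.2 ?_
      rw [hsr, add_sub_cancel_right]
      exact Ideal.mem_span_singleton'.2 ⟨s, rfl⟩
    rw [hgr] at hc ⊢
    rw [Subalgebra.mem_center_iff] at hc
    -- Commutators with `r` lie in `R h_a`, so those of degree below `n` vanish. Testing constants
    -- kills the coefficients of positive index, since no `σ^i` with `0 < i < n` is inner; testing
    -- `t` makes the constant term `σ`-fixed.
    have hcomm : ∀ p, degree (p * r - r * p) < n → p * r = r * p := by
      intro p hp
      have h1 := hc (Ideal.Quotient.mk _ p)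
      rw [← map_mul, ← map_mul, Ideal.Quotient.eq] at h1
      by_contra hne
      have h2 := degree_le_of_mem_span (sub_ne_zero.2 hne) h1
      rw [hdeg] at h2
      exact absurd hp (not_lt.2 h2)
    rw [hdeg] at hr
    have hr' := degree_lt_iff.1 hr
    have hD : ∀ y i, y * r.coeff i = r.coeff i * σ^[i] y := by
      intro y i
      have h1 := hcomm (C y) (degree_lt_iff.2 fun i hi => by
        rw [coeff_sub, coeff_C_mul, coeff_mul_C, hr' i hi, mul_zero, zero_mul, sub_zero])
      have h2 := congrArg (fun p => p.coeff i) h1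
      simpa only [coeff_C_mul, coeff_mul_C, H.phi_iterate] using h2
    have hri : ∀ i, 0 < i → r.coeff i = 0 := by
      intro i hi
      by_cases hin : n ≤ i
      · exact hr' i hin
      · by_contra hne
        refine H.not_isInner i hi (not_le.1 hin) ⟨(Units.mk0 _ hne)⁻¹, fun x => ?_⟩
        rw [inv_inv, Units.val_inv_eq_inv_val, Units.val_mk0, mul_assoc, hD x i,
          inv_mul_cancel_left₀ hne]
    have hrC : r = C (r.coeff 0) :=
      eq_C_of_degree_lt_one (degree_lt_iff.2 fun i hi => hri i (by omega))
    have hfix : IsFixedCentral σ (r.coeff 0) := by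
      refine ⟨?_, fun x => (hD x 0).symm⟩
      have h1 : X * r - r * X = monomial 1 (σ (r.coeff 0) - r.coeff 0) := by
        conv_lhs => rw [hrC]
        rw [X_mul_C, C_mul_X_eq_monomial, C_mul_X_eq_monomial, ← monomial_sub, H.twist]
      have h2 := hcomm X (by
        rw [h1, degree_lt_iff]
        intro i hi
        rw [coeff_monomial, if_neg (by omega)])
      rw [h2, sub_self] at h1
      exact sub_eq_zero.1 ((monomial_eq_zero_iff 1 _).1 h1.symm)
    obtain ⟨k, hk⟩ := (hK _).1 hfix
    refine Algebra.mem_bot.2 ⟨k, ?_⟩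
    rw [hrC, ← hk]
    rfl
  · rw [isSimpleRing_iff_isTwoSided_imp]
    constructor
    · rw [Ideal.Quotient.nontrivial_iff, Ne, Ideal.eq_top_iff_one]
      intro h1
      have := degree_le_of_mem_span one_ne_zero h1
      rw [hdeg, ← C_1, degree_C one_ne_zero, Nat.cast_le] at this
      omega
    · intro I hI
      let J : Ideal (SkewPolynomial D) := I.comap (Ideal.Quotient.mk _)
      have hJ : J.IsTwoSided := inferInstance
      have hhJ : centralBinomial u n a ∈ J := by
        rw [Ideal.mem_comap, Ideal.Quotient.eq_zero_iff_mem.2 (Ideal.mem_span_singleton_self _)]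
        exact zero_mem _
      by_cases hle : J ≤ Ideal.span {centralBinomial u n a}
      · left
        rw [eq_bot_iff]
        intro c hc
        obtain ⟨g, rfl⟩ := Ideal.Quotient.mk_surjective c
        exact Ideal.Quotient.eq_zero_iff_mem.2 (hle hc)
      · right
        have h1 := H.one_mem_of_not_le hn0 ha0 J hhJ hle
        rw [Ideal.mem_comap, map_one] at h1
        exact (Ideal.eq_top_iff_one I).2 h1

end Quotient

/-! ### The field `F` and the divisor criterion -/

section FixedField

variable {C D : Type*} [Field C] [DivisionRing D] [Algebra C D]

theorem mem_fixedField_iff [MulSemiringAction (Multiplicative ℕ) D] {σ : D ≃+* D} {u : Dˣ}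
    {n : ℕ} (H : IsInnerTwist σ u n) (c : C) :
    c ∈ fixedField C D ↔ σ (algebraMap C D c) = algebraMap C D c := by
  rw [← H.twist]
  rfl

/-- A generalised A-polynomial right divides some `u⁻¹ t ^ n - a` with `a ∈ F`. -/
theorem IsGeneralisedAPolynomial.exists_mem_span [MulSemiringAction (Multiplicative ℕ) D]
    {σ : D ≃+* D} {u : Dˣ} {n : ℕ} (H : IsInnerTwist σ u n) {f : SkewPolynomial D}
    (hf : IsGeneralisedAPolynomial C f) :
    ∃ a : fixedField C D,
      centralBinomial u n (algebraMap (fixedField C D) D a) ∈ Ideal.span {f} := by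
  have hz : centralVar u n ∈ idealiser (fixedField C D) f := by
    change f * centralVar u n ∈ Ideal.span {f}
    rw [← H.centralVar_mul]
    exact Ideal.mul_mem_left _ _ (Ideal.mem_span_singleton_self f)
  have hc : Ideal.Quotient.mk (eigenIdeal (fixedField C D) f) ⟨_, hz⟩ ∈
      Subalgebra.center (fixedField C D) (Eigenring (fixedField C D) f) := by
    rw [Subalgebra.mem_center_iff]
    intro c
    obtain ⟨g, rfl⟩ := Ideal.Quotient.mk_surjective c
    rw [← map_mul, ← map_mul]
    congr 1
    exact Subtype.ext (H.centralVar_mul _).symm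
  obtain ⟨a, ha⟩ := Algebra.mem_bot.1 (hf.central.out hc)
  refine ⟨a, ?_⟩
  have h1 : Ideal.Quotient.mk (eigenIdeal (fixedField C D) f)
      (algebraMap (fixedField C D) (idealiser (fixedField C D) f) a) =
      Ideal.Quotient.mk (eigenIdeal (fixedField C D) f) ⟨_, hz⟩ := ha
  have h2 := Ideal.Quotient.eq.1 h1.symm
  exact h2

variable [Algebra.IsCentral C D]

theorem exists_algebraMap_eq {x : D} (hx : ∀ y, x * y = y * x) : ∃ c : C, algebraMap C D c = x :=
  Algebra.mem_bot.1 (Algebra.IsCentral.out (Subalgebra.mem_center_iff.2 fun y => (hx y).symm))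

/-- An automorphism of `D` restricts to the centre. -/
theorem exists_centreRestriction (σ : D ≃+* D) :
    ∃ τ : C ≃+* C, ∀ c, algebraMap C D (τ c) = σ (algebraMap C D c) := by
  have hex : ∀ (σ : D ≃+* D) (c : C), ∃ c' : C, algebraMap C D c' = σ (algebraMap C D c) := by
    intro σ c
    refine exists_algebraMap_eq fun y => ?_
    obtain ⟨x, rfl⟩ := σ.surjective y
    rw [← map_mul, ← map_mul, Algebra.commutes]
  have hinj := (algebraMap C D).injective
  choose τ hτ using hex σ
  choose ρ hρ using hex σ.symm
  refine ⟨{ toFun := τ, invFun := ρ, left_inv := fun c => hinj ?_, right_inv := fun c => hinj ?_,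
            map_mul' := fun c c' => hinj ?_, map_add' := fun c c' => hinj ?_ }, hτ⟩
  · rw [hρ, hτ, RingEquiv.symm_apply_apply]
  · rw [hτ, hρ, RingEquiv.apply_symm_apply]
  · rw [hτ, map_mul, map_mul, map_mul, hτ, hτ]
  · rw [hτ, map_add, map_add, map_add, hτ, hτ]

variable [MulSemiringAction (Multiplicative ℕ) D] {σ : D ≃+* D} {u : Dˣ} {n : ℕ}

/-- The restriction `τ` of `σ` to `C` satisfies `τⁿ = 1`, as `σⁿ` is inner. So `F` is the fixed
field of a finite group and Artin's theorem applies. -/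
theorem finiteDimensional_fixedField (H : IsInnerTwist σ u n) (hn : 0 < n) :
    FiniteDimensional (fixedField C D) C := by
  obtain ⟨τ, hτ⟩ := exists_centreRestriction (C := C) σ
  have hτk : ∀ (k : ℕ) (c : C), algebraMap C D ((τ ^ k) c) = σ^[k] (algebraMap C D c) := by
    intro k
    induction k with
    | zero => exact fun c => rfl
    | succ k ih =>
      intro c
      rw [pow_succ, RingAut.mul_apply, ih, hτ, Function.iterate_succ_apply]
  have hτn : τ ^ n = 1 := by
    ext c
    refine (algebraMap C D).injective ?_
    rw [hτk, H.iterate_eq, ← Algebra.commutes, mul_assoc, Units.mul_inv, mul_one, RingAut.one_apply]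
  have hfin : Finite (Subgroup.zpowers τ) :=
    (isOfFinOrder_iff_pow_eq_one.2 ⟨n, hn, hτn⟩).finite_zpowers
  have heq : fixedField C D = FixedPoints.subfield (Subgroup.zpowers τ) C := by
    ext c
    rw [mem_fixedField_iff H, ← hτ, (algebraMap C D).injective.eq_iff]
    constructor
    · rintro h ⟨g, hg⟩
      have hle : Subgroup.zpowers τ ≤ MulAction.stabilizer (C ≃+* C) c := by
        rw [Subgroup.zpowers_le]
        exact h
      exact hle hg
    · intro h
      exact h ⟨τ, Subgroup.mem_zpowers τ⟩
  rw [heq]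
  infer_instance

theorem isFixedCentral_iff (H : IsInnerTwist σ u n) (x : D) :
    IsFixedCentral σ x ↔ ∃ k : fixedField C D, algebraMap (fixedField C D) D k = x := by
  constructor
  · rintro ⟨h1, h2⟩
    obtain ⟨c, rfl⟩ := exists_algebraMap_eq (C := C) h2
    exact ⟨⟨c, (mem_fixedField_iff H c).2 h1⟩, rfl⟩
  · rintro ⟨k, rfl⟩
    exact ⟨(mem_fixedField_iff H (k : C)).1 k.2, fun x => Algebra.commutes k x⟩

/-- Every proper right divisor of `u⁻¹ t ^ n - a`, with `a ∈ F` nonzero, is a generalised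
A-polynomial. -/
theorem isGeneralisedAPolynomial_of_mem_span [FiniteDimensional C D] (H : IsInnerTwist σ u n)
    (hn : 2 ≤ n) {a : D} (ha0 : a ≠ 0) (ha : IsFixedCentral σ a) {f : SkewPolynomial D}
    (hf : centralBinomial u n a ∈ Ideal.span {f}) (hf1 : 1 ∉ Ideal.span {f}) :
    IsGeneralisedAPolynomial C f := by
  have hCF : FiniteDimensional (fixedField C D) C := finiteDimensional_fixedField H (by omega)
  have : FiniteDimensional (fixedField C D) D := Module.Finite.trans C D
  have hts := H.isTwoSided_span ha
  refine isCentralSimpleAlgebra_eigenring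
    (H.isCentralSimpleAlgebra_quotient hn (isFixedCentral_iff H) ha0)
    (Ideal.Quotient.mkₐ (fixedField C D) (Ideal.span {centralBinomial u n a}))
    Ideal.Quotient.mk_surjective (fun r hr => ?_) hf1
  exact (Ideal.span_singleton_le_iff_mem _).2 hf (Ideal.Quotient.eq_zero_iff_mem.1 hr)

end FixedField

/-! ### Linear factors, norms and irreducibility -/

section Factorisation

/-- Used to change the base point `b` so that `c_m = 1`. -/
theorem Omega_mul_inv_Omega {D : Type*} [DivisionRing D] (σ : D ≃+* D) (c c' : Dˣ) (b : D) :
    Omega σ (c * c'⁻¹) (Omega σ c' b) = Omega σ c b := by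
  have h : σ ((c'⁻¹ : Dˣ) : D) * σ c' = 1 := by rw [← map_mul, Units.inv_mul, map_one]
  simp only [Omega, Units.val_mul, map_mul, mul_inv_rev, inv_inv]
  calc σ c * σ ((c'⁻¹ : Dˣ) : D) * (σ c' * b * ((c'⁻¹ : Dˣ) : D)) * (c' * ((c⁻¹ : Dˣ) : D))
      = σ c * (σ ((c'⁻¹ : Dˣ) : D) * σ c') * b * (((c'⁻¹ : Dˣ) : D) * c') *
          ((c⁻¹ : Dˣ) : D) := by simp only [mul_assoc]
    _ = _ := by rw [h, Units.inv_mul, mul_one, mul_one]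

variable {D : Type*} [DivisionRing D] [MulSemiringAction (Multiplicative ℕ) D]
  {σ : D ≃+* D} {u : Dˣ} {n : ℕ}

theorem eq_of_mem_span_of_monic {f p : SkewPolynomial D} {m : ℕ} (hf : degree f = m)
    (hp : degree p = m) (hf1 : f.coeff m = 1) (hp1 : p.coeff m = 1) (h : p ∈ Ideal.span {f}) :
    p = f := by
  by_contra hne
  have h1 := degree_le_of_mem_span (sub_ne_zero.2 hne)
    (Ideal.sub_mem _ h (Ideal.mem_span_singleton_self f))
  rw [hf] at h1
  exact absurd (degree_sub_lt hp hf (hp1.trans hf1.symm)) (not_lt.2 h1)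

theorem one_notMem_span {f : SkewPolynomial D} {m : ℕ} (hm : 0 < m) (hf : degree f = m) :
    1 ∉ Ideal.span {f} := by
  intro h
  have h1 := degree_le_of_mem_span one_ne_zero h
  rw [hf, ← C_1, degree_C one_ne_zero, Nat.cast_le] at h1
  omega

theorem degree_X_pow_sub_C {n : ℕ} (hn : 0 < n) (c : D) : degree (X ^ n - C c) = n := by
  rw [X_pow_eq_monomial, degree_eq_iff]
  refine ⟨?_, fun i hi => ?_⟩
  · rw [coeff_sub, coeff_monomial, if_pos rfl, coeff_C_ne_zero hn.ne', sub_zero]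
    exact one_ne_zero
  · rw [coeff_sub, coeff_monomial, if_neg hi.ne, coeff_C_ne_zero (by omega), sub_zero]

theorem coeff_X_pow_sub_C {n : ℕ} (hn : 0 < n) (c : D) : (X ^ n - C c).coeff n = 1 := by
  rw [X_pow_eq_monomial, coeff_sub, coeff_monomial, if_pos rfl, coeff_C_ne_zero hn.ne', sub_zero]

theorem pow_length_mem_span_prod {h : SkewPolynomial D} (hc : ∀ q, h * q = q * h)
    (l : List (SkewPolynomial D)) (hl : ∀ p ∈ l, h ∈ Ideal.span {p}) :
    h ^ l.length ∈ Ideal.span {l.prod} := by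
  induction l with
  | nil => exact Ideal.mem_span_singleton_self _
  | cons p l ih =>
    obtain ⟨g, hg⟩ := Ideal.mem_span_singleton'.1 (ih fun q hq => hl q (List.mem_cons_of_mem _ hq))
    obtain ⟨s, hs⟩ := Ideal.mem_span_singleton'.1 (hl p List.mem_cons_self)
    refine Ideal.mem_span_singleton'.2 ⟨g * s, ?_⟩
    rw [List.prod_cons, List.length_cons, pow_succ', ← hg, ← mul_assoc h, hc g, ← hs]
    simp only [mul_assoc]

theorem IsInnerTwist.mem_span_X_sub_C_Omega (H : IsInnerTwist σ u n) {a : D}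
    (ha : IsFixedCentral σ a) {b : D} (c : Dˣ)
    (hb : centralBinomial u n a ∈ Ideal.span {X - C b}) :
    centralBinomial u n a ∈ Ideal.span {X - C (Omega σ c b)} := by
  obtain ⟨g, hg⟩ := Ideal.mem_span_singleton'.1 hb
  have hσc : σ (c : D) ≠ 0 := by
    rw [map_ne_zero_iff _ σ.injective]
    exact c.ne_zero
  refine Ideal.mem_span_singleton'.2 ⟨C (c : D) * g * C (σ c)⁻¹, ?_⟩
  refine mul_right_cancel₀ (mt C_eq_zero.1 c.ne_zero) ?_
  rw [mul_assoc, H.X_sub_C_Omega_mul, H.centralBinomial_mul ha, ← hg, mul_assoc,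
    ← mul_assoc (C (σ (c : D))⁻¹), ← C_mul, inv_mul_cancel₀ hσc, C_1, one_mul, mul_assoc]

/-- Since `ua` is fixed by `σ`, applying `σ` to the norm equation changes only its norm side. -/
theorem IsInnerTwist.skewNorm_eq_iff (H : IsInnerTwist σ u n) {a : D} (ha : IsFixedCentral σ a)
    (b : D) : (u : D) * a = skewNorm σ n b ↔
      ((u⁻¹ : Dˣ) : D) * ((List.range n).map fun j => σ^[n - j] b).prod = a := by
  have hua : σ (u * a) = u * a := by rw [map_mul, H.fixed, ha.1]
  rw [← map_skewNorm, Units.inv_mul_eq_iff_eq_mul, ← hua, σ.injective.eq_iff, hua, eq_comm]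

/-- A proper factorisation would give `h_a` a right divisor of degree strictly between `0` and `n`,
hence a linear one, hence `ua` as a norm. -/
theorem IsInnerTwist.irreducible_X_pow_sub_C (H : IsInnerTwist σ u n) (hn : n.Prime) {a : D}
    (ha0 : a ≠ 0) (ha : IsFixedCentral σ a) (hb : ∀ b, (u : D) * a ≠ skewNorm σ n b) :
    Irreducible (X ^ n - C (u * a) : SkewPolynomial D) := by
  have hdeg := degree_X_pow_sub_C hn.pos ((u : D) * a)
  refine ⟨fun h => ?_, fun p q hpq => ?_⟩
  · rw [isUnit_iff_degree, hdeg, Nat.cast_inj] at h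
    exact hn.ne_zero h
  · have h0 := ne_zero_of_degree_eq hdeg
    rw [hpq] at h0
    obtain ⟨k, hk⟩ := exists_degree_eq (left_ne_zero_of_mul h0)
    obtain ⟨l, hl⟩ := exists_degree_eq (right_ne_zero_of_mul h0)
    have hkl := degree_mul_of_eq hk hl
    rw [← hpq, hdeg, Nat.cast_inj] at hkl
    rw [isUnit_iff_degree, isUnit_iff_degree, hk, hl, Nat.cast_inj, Nat.cast_inj]
    by_contra! hne
    obtain ⟨b, hb'⟩ := H.exists_X_sub_C_of_proper_divisor hn ha0 ha hl (by omega) (by omega) (by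
      rw [centralBinomial_eq_C_mul, hpq, ← mul_assoc]
      exact Ideal.mem_span_singleton'.2 ⟨_, rfl⟩)
    exact hb b ((H.mem_span_X_sub_C_iff a b).1 hb')

end Factorisation

/-! ### Using the irreducibility of `ĥ` -/

section EvalCentral

variable {C D : Type*} [Field C] [DivisionRing D] [Algebra C D]
  [MulSemiringAction (Multiplicative ℕ) D]

theorem evalCentral_X_sub_C (u : Dˣ) (n : ℕ) (a : fixedField C D) :
    evalCentral u n (Polynomial.X - Polynomial.C a) =
      centralBinomial u n (algebraMap (fixedField C D) D a) := by
  rw [evalCentral, map_sub, Polynomial.aeval_X, Polynomial.aeval_C]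
  rfl

/-- If a power of `u⁻¹ t ^ n - a` lies in `R f`, and so does `ĥ(u⁻¹ t ^ n)` with `ĥ` irreducible,
then `u⁻¹ t ^ n - a` lies in `R f`. -/
theorem centralBinomial_mem_of_pow_mem {u : Dˣ} {n : ℕ} {f : SkewPolynomial D}
    (hf : 1 ∉ Ideal.span {f}) {hhat : Polynomial (fixedField C D)} (hirr : Irreducible hhat)
    (hmem : evalCentral u n hhat ∈ Ideal.span {f}) (a : fixedField C D) (k : ℕ)
    (hpow : centralBinomial u n (algebraMap (fixedField C D) D a) ^ k ∈ Ideal.span {f}) :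
    centralBinomial u n (algebraMap (fixedField C D) D a) ∈ Ideal.span {f} := by
  rw [← evalCentral_X_sub_C] at hpow ⊢
  -- Either `ĥ` divides `x - a`, or a Bézout relation in `F[x]`, evaluated at `u⁻¹tⁿ`, puts `1` in
  -- `R f`.
  by_cases h : hhat ∣ (Polynomial.X - Polynomial.C a) ^ k
  · obtain ⟨q, hq⟩ := hirr.prime.dvd_of_dvd_pow h
    rw [hq, mul_comm, evalCentral, map_mul]
    exact Ideal.mul_mem_left _ _ hmem
  · exfalso
    obtain ⟨A, B, hAB⟩ := hirr.coprime_iff_not_dvd.2 h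
    refine hf ?_
    have h1 := congrArg (evalCentral u n) hAB
    simp only [evalCentral, map_add, map_mul, map_one, map_pow] at h1 hmem hpow
    rw [← h1]
    exact Ideal.add_mem _ (Ideal.mul_mem_left _ _ hmem) (Ideal.mul_mem_left _ _ hpow)

end EvalCentral

end GenAPoly

/-! ### The main theorem -/

theorem theorem4 {C D : Type*} [Field C] [DivisionRing D] [Algebra C D]
    [Algebra.IsCentral C D] [FiniteDimensional C D]
    (d : ℕ) (hd : Module.finrank C D = d ^ 2)
    [MulSemiringAction (Multiplicative ℕ) D]
    (σ : D ≃+* D) (hσ : ∀ x : D, SkewPolynomial.φ x = σ x)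
    (n : ℕ) (u : Dˣ)
    (hu : ∀ x : D, σ^[n] x = u * x * (u⁻¹ : Dˣ))
    (hinner : ∀ i : ℕ, 1 ≤ i → i < n → ¬ GenAPoly.IsInner (σ^[i]))
    (hσu : σ u = u)
    (m : ℕ) (hm : 1 ≤ m) (f : SkewPolynomial D)
    (hdeg : GenAPoly.degree f = m) (hmonic : f.coeff m = 1)
    (hft : GenAPoly.RightCoprime f SkewPolynomial.X)
    (hhat : Polynomial (GenAPoly.fixedField C D))
    (hmin : GenAPoly.IsMinCentralLeftMultiple u n f hhat)
    (hirr : Irreducible hhat)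
    (hn : n.Prime) (hnd : n ≠ d) :
    (GenAPoly.IsGeneralisedAPolynomial C f ↔
      (∃ a : GenAPoly.fixedField C D, a ≠ 0 ∧
        (∀ b : D, u * algebraMap (GenAPoly.fixedField C D) D a ≠
          ((List.range' 1 n).map fun j => σ^[n - j] b).prod) ∧
        f = SkewPolynomial.X ^ n -
          SkewPolynomial.C (u * algebraMap (GenAPoly.fixedField C D) D a)) ∨
      (m ≤ n ∧ ∃ (c : ℕ → Dˣ) (b : Dˣ), c m = 1 ∧
        (∃ a : GenAPoly.fixedField C D, a ≠ 0 ∧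
          ((u⁻¹ : Dˣ) : D) * ((List.range n).map fun j => σ^[n - j] (b : D)).prod =
            algebraMap (GenAPoly.fixedField C D) D a) ∧
        f = ((List.range' 1 m).map fun i =>
          SkewPolynomial.X - SkewPolynomial.C (GenAPoly.Omega σ (c i) b)).prod)) ∧
    (∀ a : GenAPoly.fixedField C D, a ≠ 0 →
      (∀ b : D, u * algebraMap (GenAPoly.fixedField C D) D a ≠
        ((List.range' 1 n).map fun j => σ^[n - j] b).prod) →
      f = SkewPolynomial.X ^ n -
        SkewPolynomial.C (u * algebraMap (GenAPoly.fixedField C D) D a) →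
      Irreducible f) := by
  have H : GenAPoly.IsInnerTwist σ u n := ⟨hσ, hu, hinner, hσu⟩
  have hfix : ∀ a : GenAPoly.fixedField C D,
      GenAPoly.IsFixedCentral σ (algebraMap (GenAPoly.fixedField C D) D a) :=
    fun a => (GenAPoly.isFixedCentral_iff H _).2 ⟨a, rfl⟩
  have hne : ∀ a : GenAPoly.fixedField C D, a ≠ 0 →
      algebraMap (GenAPoly.fixedField C D) D a ≠ 0 :=
    fun a ha => (map_ne_zero_iff _ (algebraMap (GenAPoly.fixedField C D) D).injective).2 ha
  have hf1 := GenAPoly.one_notMem_span hm hdeg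
  refine ⟨⟨fun hf => ?_, ?_⟩, ?_⟩
  · obtain ⟨a, ha⟩ := hf.exists_mem_span H
    have ha0 : a ≠ 0 := by
      rintro rfl
      refine GenAPoly.X_pow_notMem_span hm hdeg hft.coeff_zero_ne_zero n ?_
      have h1 := Ideal.mul_mem_left _ (SkewPolynomial.C (u : D)) ha
      rwa [GenAPoly.C_mul_centralBinomial, map_zero, mul_zero, map_zero, sub_zero] at h1
    have hdh := GenAPoly.degree_centralBinomial u hn.pos
      (algebraMap (GenAPoly.fixedField C D) D a)
    have hmn : m ≤ n := by
      have h1 := GenAPoly.degree_le_of_mem_span (GenAPoly.ne_zero_of_degree_eq hdh) ha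
      rwa [hdeg, hdh, Nat.cast_le] at h1
    by_cases hb : ∃ b, (u : D) * algebraMap (GenAPoly.fixedField C D) D a =
        GenAPoly.skewNorm σ n b
    · right
      obtain ⟨b, hb⟩ := hb
      rw [← H.mem_span_X_sub_C_iff] at hb
      obtain ⟨c, hc⟩ := H.exists_eq_prod_X_sub_C_Omega hn.pos (hne a ha0) (hfix a) hb m f hdeg
        hmonic ha
      have hb' := (H.mem_span_X_sub_C_iff _ _).1 (H.mem_span_X_sub_C_Omega (hfix a) (c m) hb)
      have hb0 : GenAPoly.Omega σ (c m) b ≠ 0 := by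
        intro h0
        obtain ⟨k, hk⟩ := Nat.exists_eq_succ_of_ne_zero hn.ne_zero
        rw [h0, hk, GenAPoly.skewNorm_succ, mul_zero] at hb'
        exact mul_ne_zero u.ne_zero (hne a ha0) hb'
      -- Replacing `b` by `Ω_{c_m}(b)` and `c_i` by `c_i c_m⁻¹` keeps every factor and achieves `c_m
      -- = 1`.
      refine ⟨hmn, fun i => c i * (c m)⁻¹, Units.mk0 _ hb0, mul_inv_cancel _,
        ⟨a, ha0, (H.skewNorm_eq_iff (hfix a) _).1 hb'⟩, ?_⟩
      rw [hc]
      simp only [Units.val_mk0, GenAPoly.Omega_mul_inv_Omega]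
    · left
      push Not at hb
      refine ⟨a, ha0, hb, ?_⟩
      -- If `m < n`, `f` is a proper right divisor, which forces a linear one and makes `ua` a norm.
      obtain rfl : m = n := by
        by_contra hne'
        obtain ⟨b, hb'⟩ := H.exists_X_sub_C_of_proper_divisor hn (hne a ha0) (hfix a) hdeg hm
          (lt_of_le_of_ne hmn hne') ha
        exact hb b ((H.mem_span_X_sub_C_iff _ b).1 hb')
      refine (GenAPoly.eq_of_mem_span_of_monic hdeg (GenAPoly.degree_X_pow_sub_C hn.pos _) hmonic
        (GenAPoly.coeff_X_pow_sub_C hn.pos _) ?_).symm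
      rw [← GenAPoly.C_mul_centralBinomial]
      exact Ideal.mul_mem_left _ _ ha
  · rintro (⟨a, ha0, -, rfl⟩ | ⟨-, c, b, -, ⟨a, ha0, hab⟩, hfc⟩)
    · refine GenAPoly.isGeneralisedAPolynomial_of_mem_span H hn.two_le (hne a ha0) (hfix a) ?_ hf1
      rw [GenAPoly.centralBinomial_eq_C_mul]
      exact Ideal.mul_mem_left _ _ (Ideal.mem_span_singleton_self _)
    · refine GenAPoly.isGeneralisedAPolynomial_of_mem_span H hn.two_le (hne a ha0) (hfix a) ?_ hf1
      have hb := (H.mem_span_X_sub_C_iff _ _).2 ((H.skewNorm_eq_iff (hfix a) _).2 hab)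
      obtain ⟨g, hg⟩ := hmin.leftMultiple
      have hpow := GenAPoly.pow_length_mem_span_prod (H.centralBinomial_mul (hfix a))
        ((List.range' 1 m).map fun i =>
          SkewPolynomial.X - SkewPolynomial.C (GenAPoly.Omega σ (c i) b)) fun p hp => by
          obtain ⟨i, -, rfl⟩ := List.mem_map.1 hp
          exact H.mem_span_X_sub_C_Omega (hfix a) (c i) hb
      rw [← hfc] at hpow
      exact GenAPoly.centralBinomial_mem_of_pow_mem hf1 hirr
        (Ideal.mem_span_singleton'.2 ⟨g, hg.symm⟩) a _ hpow
  · rintro a ha0 hb rfl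
    exact H.irreducible_X_pow_sub_C hn (hne a ha0) (hfix a) hb
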